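/- Let $(M,g)$ be a smooth ($C^\infty$, Hausdorff, without boundary) finite-dimensional pseudo-Riemannian manifold with contravariant metric $G$ and Levi-Civita connection $\nabla$; for a function $f$, $\nabla f$ denotes its gradient. Let $T$ be a smooth symmetric contravariant tensor field of valence $2$ whose associated endomorphism field of $TM$ is at every point diagonalizable over $\mathbb{R}$ (an orthogonal tensor). Let $(\lambda_i)_{i=1}^k$ be its eigenfunctions: at each point the numbers $\lambda_1,\dots,\lambda_k$ are pairwise distinct and are exactly the eigenvalues of $T$. Let $E_i=\ker(T-\lambda_i I)$ be the corresponding eigenspaces and suppose that they are orthogonally integrable: they are distributions which are nondegenerate, $TM=\bigoplus_i E_i$ is an orthogonal direct sum, and every point of $M$ has a neighbourhood $U$ with a diffeomorphism $\prod_{i=1}^k M_i\to U$ from a product manifold that maps every slice in the direction of $M_i$ to an integral manifold of $E_i$. For a vector $x$ write $x=\sum_i x^i$ with $x^i\in E_i$. For a nondegenerate distribution $E$ of rank $m$ and sections $X,Y$ of $E$ put $s^E(X,Y)=(\nabla_XY)^{E^\perp}$ and $h^E(X,Y)=\frac12\bigl(s^E(X,Y)+s^E(Y,X)\bigr)$.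 The mean curvature normal of $E$ is $H_E=\frac1m\operatorname{tr}h^E$ (trace with respect to $g|_E$), and $E$ is umbilical if $s^E(X,Y)=g(X,Y)\,H_E$ for all sections $X,Y$ of $E$. For a smooth vector field $t$, $T$ is a conformal Killing tensor with conformal factor $t$ if $[T,G]=-2\,t\odot G$, where $\odot$ is the symmetrized product and $[\cdot,\cdot]$ is the Schouten bracket of symmetric contravariant tensors; for tensors $K,Q$ of valence $2$ it is determined by $[K,Q](df,df,df)=2K(df,d(Q(df,df)))-2Q(df,d(K(df,df)))$ for all smooth functions $f$. Then, for every smooth vector field $t$, $T$ is a conformal Killing tensor with conformal factor $t$ if and only if the following three conditions hold: 1. every eigenspace $E_i$ is umbilical; 2. for every $i$, the mean curvature normal $H_i$ of $E_i$ satisfies $$H_i=-\frac12\sum_{j\ne i}\bigl(\nabla\log|\lambda_i-\lambda_j|\bigr)^j;$$ 3. $$t=\sum_i(\nabla\lambda_i)^i .$$ -/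

import Mathlib

open scoped Manifold ContDiff Bundle

noncomputable section

namespace PseudoRiem

/-- A smooth pseudo-Riemannian metric: a smooth field of nondegenerate symmetric bilinear forms,
of arbitrary signature, on the tangent spaces of `M` (a manifold without boundary modelled on the
vector space `E`). -/
structure Metric (E M : Type*) [NormedAddCommGroup E] [NormedSpace ℝ E]
    [TopologicalSpace M] [ChartedSpace E M] [IsManifold 𝓘(ℝ, E) ∞ M] where
  val : ∀ p : M, TangentSpace 𝓘(ℝ, E) p →L[ℝ] TangentSpace 𝓘(ℝ, E) p →L[ℝ] ℝ
  symm : ∀ p v w, val p v w = val p w v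
  nondegenerate : ∀ p v, (∀ w, val p v w = 0) → v = 0
  contMDiff : ContMDiff 𝓘(ℝ, E) (𝓘(ℝ, E).prod 𝓘(ℝ, E →L[ℝ] E →L[ℝ] ℝ)) ∞
    (fun p => Bundle.TotalSpace.mk' (E →L[ℝ] E →L[ℝ] ℝ) p (val p))

/-- A smooth symmetric contravariant tensor field of valence 2: a field of symmetric bilinear
forms on the cotangent spaces of `M` which is smooth, that is, its value on two one-forms is
smooth wherever the one-forms are. -/
structure SymTensor (E M : Type*) [NormedAddCommGroup E] [NormedSpace ℝ E]
    [TopologicalSpace M] [ChartedSpace E M] [IsManifold 𝓘(ℝ, E) ∞ M] where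
  val : ∀ p : M, LinearMap.BilinForm ℝ (TangentSpace 𝓘(ℝ, E) p →L[ℝ] ℝ)
  symm : ∀ p α β, val p α β = val p β α
  contMDiffAt : ∀ (p : M) (α β : ∀ q : M, TangentSpace 𝓘(ℝ, E) q →L[ℝ] ℝ),
    ContMDiffAt 𝓘(ℝ, E) (𝓘(ℝ, E).prod 𝓘(ℝ, E →L[ℝ] ℝ)) ∞
      (fun q => Bundle.TotalSpace.mk' (E →L[ℝ] ℝ) q (α q)) p →
    ContMDiffAt 𝓘(ℝ, E) (𝓘(ℝ, E).prod 𝓘(ℝ, E →L[ℝ] ℝ)) ∞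
      (fun q => Bundle.TotalSpace.mk' (E →L[ℝ] ℝ) q (β q)) p →
    ContMDiffAt 𝓘(ℝ, E) 𝓘(ℝ, ℝ) ∞ (fun q => val q (α q) (β q)) p

section

variable {E M : Type*} [NormedAddCommGroup E] [NormedSpace ℝ E]
  [TopologicalSpace M] [ChartedSpace E M]

/-- `X` is a smooth vector field on `M`. -/
def IsSmoothField [IsManifold 𝓘(ℝ, E) ∞ M] (X : ∀ p : M, TangentSpace 𝓘(ℝ, E) p) : Prop :=
  ContMDiff 𝓘(ℝ, E) (𝓘(ℝ, E).prod 𝓘(ℝ, E)) ∞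
    (fun p => (Bundle.TotalSpace.mk' E p (X p) : TangentBundle 𝓘(ℝ, E) M))

/-- The differential of a real function at a point. -/
abbrev diff (f : M → ℝ) (p : M) : TangentSpace 𝓘(ℝ, E) p →L[ℝ] ℝ :=
  mvfderiv 𝓘(ℝ, E) f p

end

section

variable {E M : Type*} [NormedAddCommGroup E] [NormedSpace ℝ E] [FiniteDimensional ℝ E]
  [TopologicalSpace M] [ChartedSpace E M] [IsManifold 𝓘(ℝ, E) ∞ M]

instance (p : M) : FiniteDimensional ℝ (TangentSpace 𝓘(ℝ, E) p) :=
  inferInstanceAs (FiniteDimensional ℝ E)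

/-- The lowering of indices `v ↦ g(v, ·)` as an isomorphism onto the cotangent space. -/
def Metric.flat (g : Metric E M) (p : M) :
    TangentSpace 𝓘(ℝ, E) p ≃ₗ[ℝ] Module.Dual ℝ (TangentSpace 𝓘(ℝ, E) p) :=
  LinearEquiv.ofInjectiveOfFinrankEq
    ((ContinuousLinearMap.coeLM ℝ).comp (g.val p).toLinearMap)
    (by
      rw [injective_iff_map_eq_zero]
      intro v hv
      exact g.nondegenerate p v fun w => LinearMap.congr_fun hv w)
    (Subspace.dual_finrank_eq).symm

/-- The raising of indices: `g (sharp α) v = α v`. -/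
def Metric.sharp (g : Metric E M) (p : M) :
    Module.Dual ℝ (TangentSpace 𝓘(ℝ, E) p) ≃ₗ[ℝ] TangentSpace 𝓘(ℝ, E) p :=
  (g.flat p).symm

theorem Metric.val_sharp (g : Metric E M) (p : M)
    (α : Module.Dual ℝ (TangentSpace 𝓘(ℝ, E) p)) (v : TangentSpace 𝓘(ℝ, E) p) :
    g.val p (g.sharp p α) v = α v :=
  LinearMap.congr_fun ((g.flat p).apply_symm_apply α) v

/-- The gradient of a function. -/
def Metric.grad (g : Metric E M) (f : M → ℝ) (p : M) : TangentSpace 𝓘(ℝ, E) p :=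
  g.sharp p (diff f p).toLinearMap

/-- The contravariant metric `G`, as a bilinear form on covectors. -/
def Metric.contra (g : Metric E M) (p : M) (α β : TangentSpace 𝓘(ℝ, E) p →L[ℝ] ℝ) : ℝ :=
  α (g.sharp p β.toLinearMap)

/-! ### Levi-Civita connection -/

/-- The right-hand side of the Koszul formula for `2 g(∇_X Y, Z)`. -/
def Metric.koszul (g : Metric E M) (X Y Z : ∀ p : M, TangentSpace 𝓘(ℝ, E) p) (p : M) : ℝ :=
  diff (fun q => g.val q (Y q) (Z q)) p (X p)
    + diff (fun q => g.val q (X q) (Z q)) p (Y p)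
    - diff (fun q => g.val q (X q) (Y q)) p (Z p)
    + g.val p (VectorField.mlieBracket 𝓘(ℝ, E) X Y p) (Z p)
    - g.val p (VectorField.mlieBracket 𝓘(ℝ, E) X Z p) (Y p)
    - g.val p (VectorField.mlieBracket 𝓘(ℝ, E) Y Z p) (X p)

/-- The Levi-Civita covariant derivative `∇_X Y`: the vector field with
`2 g(∇_X Y, Z) = koszul X Y Z`. At a point `p` it is enough to impose this for `Z` running
through local extensions of a basis of the tangent space, since the right-hand side depends on
`Z` only through its value at `p` when `X` and `Y` are differentiable. -/
def Metric.leviCivita (g : Metric E M) (X Y : ∀ p : M, TangentSpace 𝓘(ℝ, E) p) (p : M) :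
    TangentSpace 𝓘(ℝ, E) p :=
  g.sharp p ((Module.finBasis ℝ (TangentSpace 𝓘(ℝ, E) p)).constr ℝ fun a =>
    (1 / 2 : ℝ) * g.koszul X Y
      (FiberBundle.extend E (Module.finBasis ℝ (TangentSpace 𝓘(ℝ, E) p) a)) p)

/-! ### Orthogonal splittings and the geometry of a distribution -/

/-- The orthogonal complement of a subspace of a tangent space. -/
def Metric.perp (g : Metric E M) (p : M) (S : Submodule ℝ (TangentSpace 𝓘(ℝ, E) p)) :
    Submodule ℝ (TangentSpace 𝓘(ℝ, E) p) where
  carrier := {v | ∀ w ∈ S, g.val p v w = 0}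
  add_mem' := by
    intro a b ha hb w hw
    simp [ha w hw, hb w hw]
  zero_mem' := by simp
  smul_mem' := by
    intro c a ha w hw
    simp [ha w hw]

open Classical in
/-- The orthogonal projection of a tangent space onto a subspace `S` on which the metric is
nondegenerate (equivalently, which is complementary to its orthogonal complement);
by convention `0` for degenerate `S`. -/
def Metric.proj (g : Metric E M) (p : M) (S : Submodule ℝ (TangentSpace 𝓘(ℝ, E) p)) :
    TangentSpace 𝓘(ℝ, E) p →ₗ[ℝ] TangentSpace 𝓘(ℝ, E) p :=
  if h : IsCompl S (g.perp p S) then S.projection (g.perp p S) h else 0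

/-- The second fundamental form `s(X, Y) = (∇_X Y)^⊥` of a distribution `D`, for sections
`X`, `Y` of `D`, with values in the orthogonal complement of `D`. -/
def Metric.sff (g : Metric E M) (D : ∀ p : M, Submodule ℝ (TangentSpace 𝓘(ℝ, E) p))
    (X Y : ∀ p : M, TangentSpace 𝓘(ℝ, E) p) (p : M) : TangentSpace 𝓘(ℝ, E) p :=
  g.leviCivita X Y p - g.proj p (D p) (g.leviCivita X Y p)

/-- A section of the distribution `D` defined near `p` and with value `x` at `p`, when
`x ∈ D p`. -/
def Metric.extendIn (g : Metric E M) (D : ∀ p : M, Submodule ℝ (TangentSpace 𝓘(ℝ, E) p))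
    (p : M) (x : TangentSpace 𝓘(ℝ, E) p) (q : M) : TangentSpace 𝓘(ℝ, E) q :=
  g.proj q (D q) (FiberBundle.extend E x q)

/-- The symmetric part `h(x, y) = (s(x, y) + s(y, x)) / 2` of the second fundamental form, as a
tensor: it is evaluated on vectors `x`, `y` of `D p` by extending them to sections of `D`. -/
def Metric.symmSff (g : Metric E M) (D : ∀ p : M, Submodule ℝ (TangentSpace 𝓘(ℝ, E) p))
    (p : M) (x y : TangentSpace 𝓘(ℝ, E) p) : TangentSpace 𝓘(ℝ, E) p :=
  (1 / 2 : ℝ) • (g.sff D (g.extendIn D p x) (g.extendIn D p y) p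
    + g.sff D (g.extendIn D p y) (g.extendIn D p x) p)

/-- The matrix of the metric restricted to `D p` in a basis of `D p`. -/
def Metric.gram (g : Metric E M) (D : ∀ p : M, Submodule ℝ (TangentSpace 𝓘(ℝ, E) p)) (p : M) :
    Matrix (Fin (Module.finrank ℝ (D p))) (Fin (Module.finrank ℝ (D p))) ℝ :=
  Matrix.of fun a b => g.val p (Module.finBasis ℝ (D p) a) (Module.finBasis ℝ (D p) b)

/-- The mean curvature normal `H = (1/m) tr h` of a distribution `D` of rank `m`. -/
def Metric.meanCurvatureNormal (g : Metric E M)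
    (D : ∀ p : M, Submodule ℝ (TangentSpace 𝓘(ℝ, E) p)) (p : M) : TangentSpace 𝓘(ℝ, E) p :=
  (Module.finrank ℝ (D p) : ℝ)⁻¹ •
    ∑ a, ∑ b, (g.gram D p)⁻¹ a b •
      g.symmSff D p (Module.finBasis ℝ (D p) a) (Module.finBasis ℝ (D p) b)

/-- `D` is umbilical: `s(X, Y) = g(X, Y) H` for all smooth sections `X`, `Y` of `D`, where `H`
is the mean curvature normal of `D`. -/
def Metric.IsUmbilical (g : Metric E M)
    (D : ∀ p : M, Submodule ℝ (TangentSpace 𝓘(ℝ, E) p)) : Prop :=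
  ∀ X Y : ∀ p : M, TangentSpace 𝓘(ℝ, E) p, IsSmoothField X → IsSmoothField Y →
    (∀ p, X p ∈ D p) → (∀ p, Y p ∈ D p) →
    ∀ p, g.sff D X Y p = g.val p (X p) (Y p) • g.meanCurvatureNormal D p

/-! ### Integrable nets -/

/-- A family of distributions is an integrable net if it splits the tangent bundle into an
orthogonal direct sum of nondegenerate subspaces and `M` is locally diffeomorphic to a product in
such a way that the slices are integral manifolds of the distributions. As this is local, the
factors of the product are taken to be open subsets `U i` of Euclidean spaces of dimension `m i`;
`φ` is the diffeomorphism from their product onto a neighbourhood of the given point. -/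
structure Metric.IsIntegrableNet (g : Metric E M) {ι : Type*} [Fintype ι] [DecidableEq ι]
    (D : ι → ∀ p : M, Submodule ℝ (TangentSpace 𝓘(ℝ, E) p)) : Prop where
  nondegenerate : ∀ i p, ∀ v ∈ D i p, (∀ w ∈ D i p, g.val p v w = 0) → v = 0
  orthogonal : ∀ i j, i ≠ j → ∀ p, ∀ v ∈ D i p, ∀ w ∈ D j p, g.val p v w = 0
  directSum : ∀ p, DirectSum.IsInternal fun i => D i p
  adapted : ∀ p : M, ∃ (m : ι → ℕ) (U : ∀ i, Set (EuclideanSpace ℝ (Fin (m i))))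
    (φ : OpenPartialHomeomorph (∀ i, EuclideanSpace ℝ (Fin (m i))) M),
    (∀ i, IsOpen (U i)) ∧ φ.source = Set.pi Set.univ U ∧ p ∈ φ.target ∧
    ContMDiffOn 𝓘(ℝ, ∀ i, EuclideanSpace ℝ (Fin (m i))) 𝓘(ℝ, E) ∞ φ φ.source ∧
    ContMDiffOn 𝓘(ℝ, E) 𝓘(ℝ, ∀ i, EuclideanSpace ℝ (Fin (m i))) ∞ φ.symm φ.target ∧
    ∀ q ∈ φ.source, ∀ i, (D i (φ q) : Set (TangentSpace 𝓘(ℝ, E) (φ q))) =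
      Set.range fun v : EuclideanSpace ℝ (Fin (m i)) =>
        mfderiv 𝓘(ℝ, ∀ i, EuclideanSpace ℝ (Fin (m i))) 𝓘(ℝ, E) φ q (Pi.single i v)

/-! ### Orthogonal tensors -/

/-- The endomorphism of the tangent space associated with `T`, characterised by
`g(endo v, u) = T(g(u, ·), g(v, ·))`. -/
def SymTensor.endo (T : SymTensor E M) (g : Metric E M) (p : M) :
    TangentSpace 𝓘(ℝ, E) p →ₗ[ℝ] TangentSpace 𝓘(ℝ, E) p where
  toFun v := g.sharp p ((T.val p (g.val p v)).comp (g.val p).toLinearMap)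
  map_add' v w := by
    rw [← map_add]
    congr 1
    ext u
    simp
  map_smul' c v := by
    rw [RingHom.id_apply, ← map_smul]
    congr 1
    ext u
    simp

/-- `T` is an orthogonal tensor: its endomorphism is pointwise diagonalizable over `ℝ`. -/
def SymTensor.IsOrthogonal (T : SymTensor E M) (g : Metric E M) : Prop :=
  ∀ p, ⨆ μ : ℝ, Module.End.eigenspace (T.endo g p) μ = ⊤

/-- `(l i)` is the family of eigenfunctions of `T`: at each point the `l i p` are pairwise
distinct and are all the eigenvalues of the endomorphism of `T`. -/
structure SymTensor.IsEigenfunctions (T : SymTensor E M) (g : Metric E M) {ι : Type*}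
    (l : ι → M → ℝ) : Prop where
  distinct : ∀ p, Function.Injective fun i => l i p
  hasEigenvalue_iff : ∀ p μ, Module.End.HasEigenvalue (T.endo g p) μ ↔ ∃ i, l i p = μ

/-- The eigenspaces `ker (T - f)` of an eigenfunction `f`, as a distribution. -/
def SymTensor.eigendist (T : SymTensor E M) (g : Metric E M) (f : M → ℝ) (p : M) :
    Submodule ℝ (TangentSpace 𝓘(ℝ, E) p) :=
  Module.End.eigenspace (T.endo g p) (f p)

/-! ### Conformal Killing tensors -/

/-- The Schouten bracket `[K, Q]` of symmetric contravariant fields of valence 2, evaluated on the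
differentials of three functions. It is the polarization of
`[K, Q](df, df, df) = 2 K(df, d(Q(df, df))) - 2 Q(df, d(K(df, df)))`, so that in coordinates it is
the symmetrization over `i, j, k` of `2 K^{li} ∂_l Q^{jk} - 2 Q^{li} ∂_l K^{jk}`; it corresponds
to the Poisson bracket of the associated fibrewise quadratic functions on the cotangent bundle. -/
def schouten (K Q : ∀ p : M, (TangentSpace 𝓘(ℝ, E) p →L[ℝ] ℝ) →
      (TangentSpace 𝓘(ℝ, E) p →L[ℝ] ℝ) → ℝ) (f₁ f₂ f₃ : M → ℝ) (p : M) : ℝ :=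
  let term (a b c : M → ℝ) : ℝ :=
    2 * K p (diff a p) (diff (fun q => Q q (diff b q) (diff c q)) p)
      - 2 * Q p (diff a p) (diff (fun q => K q (diff b q) (diff c q)) p)
  (1 / 3 : ℝ) * (term f₁ f₂ f₃ + term f₂ f₃ f₁ + term f₃ f₁ f₂)

/-- The symmetric product `t ⊙ G` of a vector and a symmetric bilinear form on covectors. -/
def symProd {p : M} (t : TangentSpace 𝓘(ℝ, E) p)
    (G : (TangentSpace 𝓘(ℝ, E) p →L[ℝ] ℝ) → (TangentSpace 𝓘(ℝ, E) p →L[ℝ] ℝ) → ℝ)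
    (α β γ : TangentSpace 𝓘(ℝ, E) p →L[ℝ] ℝ) : ℝ :=
  (1 / 3 : ℝ) * (α t * G β γ + β t * G γ α + γ t * G α β)

/-- `T` is a conformal Killing tensor with conformal factor `t`: `[T, G] = -2 t ⊙ G`. Every
covector is the differential of a smooth function, so it is enough to test the equality of these
symmetric tensors of valence 3 on differentials. -/
def SymTensor.IsConformalKilling (T : SymTensor E M) (g : Metric E M)
    (t : ∀ p : M, TangentSpace 𝓘(ℝ, E) p) : Prop :=
  ∀ f₁ f₂ f₃ : M → ℝ, ContMDiff 𝓘(ℝ, E) 𝓘(ℝ, ℝ) ∞ f₁ → ContMDiff 𝓘(ℝ, E) 𝓘(ℝ, ℝ) ∞ f₂ →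
    ContMDiff 𝓘(ℝ, E) 𝓘(ℝ, ℝ) ∞ f₃ → ∀ p : M,
    schouten (fun q α β => T.val q α β) g.contra f₁ f₂ f₃ p
      = -2 * symProd (t p) (g.contra p) (diff f₁ p) (diff f₂ p) (diff f₃ p)

end

end PseudoRiem

end

/-!
Around every point the net provides a parametrization by an open subset of a product of vector
spaces in which the eigenspaces are the constant factors: with `P i` the coordinate projections,
the metric reads `ĝ = ∑ i, ĝ (P i ·) (P i ·)` and the endomorphism of `T` reads `∑ i, λ i • P i`.
There the conformal Killing equation says that the cyclic sum of a trilinear form vanishes, and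
splitting it along the blocks gives two kinds of conditions. Three vectors in block `i` give
`dλ_i = ĝ (t, ·)` on that block, which determines `t`. A vector `x` in block `i` and two vectors in
another block `j` give `(λ_j - λ_i) ∂_x ĝ = (∂_x λ_j - ∂_x λ_i) ĝ` on block `j`. Since the second
fundamental form of a coordinate block is `-1/2` times the derivative of `ĝ` in the normal
directions, the latter says that the `j`-th eigenspace is umbilical with the asserted normal.
-/

namespace PseudoRiem

theorem eq_zero_or_of_cyclic_sum_eq_zero {V : Type*} {α : V → ℝ} {b : V → V → ℝ}
    (hb : ∀ x y, b x y = b y x)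
    (h : ∀ x y z, α x * b y z + α y * b z x + α z * b x y = 0) (x : V) :
    α x = 0 ∨ ∀ y, b x y = 0 := by
  refine or_iff_not_imp_left.2 fun hx y => ?_
  have hxx : b x x = 0 := (mul_eq_zero.1 (by linarith [h x x x] : α x * b x x = 0)).resolve_left hx
  have hxy : α x * b x y = 0 := by
    have := h x x y
    rw [hxx, hb y x, mul_zero] at this
    linarith
  exact (mul_eq_zero.1 hxy).resolve_left hx

noncomputable section BlockAlgebra

variable {V ι : Type*} [NormedAddCommGroup V] [NormedSpace ℝ V]

/-- The projection of a product of vector spaces onto a factor, as an endomorphism of the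
product. -/
def coordProj [DecidableEq ι] (W : ι → Type*) [∀ i, NormedAddCommGroup (W i)]
    [∀ i, NormedSpace ℝ (W i)] (i : ι) : (∀ i, W i) →L[ℝ] ∀ i, W i :=
  (ContinuousLinearMap.single ℝ W i).comp (ContinuousLinearMap.proj i)

/-- The blocks of the decomposition of `V` given by the projections `P` are orthogonal for the
bilinear form `b`; equivalently, the projections are self-adjoint for `b`. -/
def IsBlockDiag (P : ι → V →L[ℝ] V) (b : V →L[ℝ] V →L[ℝ] ℝ) : Prop :=
  ∀ i x y, b (P i x) y = b x (P i y)

/-- The endomorphism of `V` that multiplies the `i`-th block by `c i`, as a linear function of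
`c`. -/
def blockScalar [Fintype ι] (P : ι → V →L[ℝ] V) : (ι → ℝ) →ₗ[ℝ] V →L[ℝ] V :=
  Fintype.linearCombination ℝ P

/-- The form whose cyclic sum is the Schouten bracket of the contravariant tensors given by an
endomorphism field and the inverse of a metric: `S` and `g` are the values at a point of the
endomorphism field and the metric in a chart, `DS` and `Dg` those of their derivatives, and the
arguments are gradients. -/
def bracketForm (g : V →L[ℝ] V →L[ℝ] ℝ) (Dg : V → V →L[ℝ] V →L[ℝ] ℝ) (S : V →L[ℝ] V)
    (DS : V → V →L[ℝ] V) (x y z : V) : ℝ :=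
  Dg x y (S z) - Dg (S x) y z - g (DS x y) z

/-- The conformal Killing equation with factor `t` at a point of a chart. -/
def KillingEq (g : V →L[ℝ] V →L[ℝ] ℝ) (Dg : V → V →L[ℝ] V →L[ℝ] ℝ) (S : V →L[ℝ] V)
    (DS : V → V →L[ℝ] V) (t : V) : Prop :=
  ∀ x y z, bracketForm g Dg S DS x y z + bracketForm g Dg S DS y z x + bracketForm g Dg S DS z x y
    = -(g t x * g y z + g t y * g z x + g t z * g x y)

variable {P : ι → V →L[ℝ] V} {b g : V →L[ℝ] V →L[ℝ] ℝ} {Dg : V →ₗ[ℝ] V →L[ℝ] V →L[ℝ] ℝ}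
  {l : ι → ℝ} {dl : ι → V →L[ℝ] ℝ} {t : V}

variable [Fintype ι]

theorem completeOrthogonalIdempotents_coordProj [DecidableEq ι] (W : ι → Type*)
    [∀ i, NormedAddCommGroup (W i)] [∀ i, NormedSpace ℝ (W i)] :
    CompleteOrthogonalIdempotents (coordProj W) where
  idem i := ContinuousLinearMap.ext fun v => by simp [coordProj]
  ortho i j hij := ContinuousLinearMap.ext fun v => by simp [coordProj, hij]
  complete := ContinuousLinearMap.ext fun v => by simp [coordProj, Finset.univ_sum_single]

theorem bracketForm_sum_left (S : V →L[ℝ] V) (DS : V →ₗ[ℝ] V →L[ℝ] V) (x : ι → V) (y z : V) :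
    bracketForm g Dg S DS (∑ i, x i) y z = ∑ i, bracketForm g Dg S DS (x i) y z := by
  unfold bracketForm
  simp only [map_sum, sum_apply, Finset.sum_sub_distrib]

theorem bracketForm_sum_middle (S : V →L[ℝ] V) (DS : V → V →L[ℝ] V) (x : V) (y : ι → V) (z : V) :
    bracketForm g Dg S DS x (∑ i, y i) z = ∑ i, bracketForm g Dg S DS x (y i) z := by
  simp only [bracketForm, map_sum, sum_apply, Finset.sum_sub_distrib]

theorem sum_proj_apply (hP : CompleteOrthogonalIdempotents P) (x : V) : ∑ i, P i x = x := by
  rw [← sum_apply, hP.complete, one_apply_eq_self]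

theorem proj_proj_of_ne (hP : CompleteOrthogonalIdempotents P) {i j : ι} (hij : i ≠ j) (x : V) :
    P i (P j x) = 0 :=
  DFunLike.congr_fun (hP.ortho hij) x

theorem proj_proj_self (hP : CompleteOrthogonalIdempotents P) (i : ι) (x : V) :
    P i (P i x) = P i x :=
  DFunLike.congr_fun (hP.idem i) x

theorem sub_proj_eq_sum_erase [DecidableEq ι] (hP : CompleteOrthogonalIdempotents P) (i : ι)
    (x : V) : x - P i x = ∑ j ∈ Finset.univ.erase i, P j x := by
  rw [sub_eq_iff_eq_add', Finset.add_sum_erase _ (fun j => P j x) (Finset.mem_univ i),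
    sum_proj_apply hP]

theorem blockScalar_proj (hP : CompleteOrthogonalIdempotents P) (c : ι → ℝ) (i : ι) (x : V) :
    blockScalar P c (P i x) = c i • P i x := by
  simp only [blockScalar, Fintype.linearCombination_apply, sum_apply, smul_apply]
  rw [Finset.sum_eq_single i (fun j _ hj => by rw [proj_proj_of_ne hP hj, smul_zero])
    (fun h => absurd (Finset.mem_univ i) h), proj_proj_self hP]

theorem proj_blockScalar (hP : CompleteOrthogonalIdempotents P) (c : ι → ℝ) (i : ι) (x : V) :
    P i (blockScalar P c x) = c i • P i x := by
  simp only [blockScalar, Fintype.linearCombination_apply, sum_apply, smul_apply, map_sum,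
    map_smul]
  rw [Finset.sum_eq_single i (fun j _ hj => by rw [proj_proj_of_ne hP hj.symm, smul_zero])
    (fun h => absurd (Finset.mem_univ i) h), proj_proj_self hP]

theorem isBlockDiag_of_orthogonal (hP : CompleteOrthogonalIdempotents P)
    (hb : ∀ i j, i ≠ j → ∀ x y, b (P i x) (P j y) = 0) : IsBlockDiag P b := by
  intro i x y
  have hleft : b (P i x) y = b (P i x) (P i y) := by
    conv_lhs => rw [← sum_proj_apply hP y, map_sum]
    exact Fintype.sum_eq_single i fun j hj => hb i j hj.symm x y
  have hright : b x (P i y) = b (P i x) (P i y) := by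
    conv_lhs => rw [← sum_proj_apply hP x, map_sum, sum_apply]
    exact Fintype.sum_eq_single i fun j hj => hb j i hj x y
  rw [hleft, hright]

theorem IsBlockDiag.proj_proj_of_ne (hb : IsBlockDiag P b) (hP : CompleteOrthogonalIdempotents P)
    {i j : ι} (hij : i ≠ j) (x y : V) : b (P i x) (P j y) = 0 := by
  rw [hb, PseudoRiem.proj_proj_of_ne hP hij, map_zero]

theorem IsBlockDiag.proj_proj_self (hb : IsBlockDiag P b) (hP : CompleteOrthogonalIdempotents P)
    (i : ι) (x y : V) : b (P i x) (P i y) = b (P i x) y := by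
  rw [← hb, PseudoRiem.proj_proj_self hP]

theorem IsBlockDiag.blockScalar_right (hb : IsBlockDiag P b)
    (hP : CompleteOrthogonalIdempotents P) (i : ι) (x y : V) :
    b (P i x) (blockScalar P l y) = l i * b (P i x) y := by
  rw [← hb.proj_proj_self hP, proj_blockScalar hP, map_smul, smul_eq_mul, hb.proj_proj_self hP]

theorem bracketForm_proj_proj (hP : CompleteOrthogonalIdempotents P)
    (hDg : ∀ z, IsBlockDiag P (Dg z)) (i j : ι) (x y z : V) :
    bracketForm g Dg (blockScalar P l) (fun x => blockScalar P fun i => dl i x) (P i x) (P j y) z =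
      (l j - l i) * Dg (P i x) (P j y) z - dl j (P i x) * g (P j y) z := by
  simp only [bracketForm, (hDg _).blockScalar_right hP, blockScalar_proj hP, map_smul, smul_apply,
    smul_eq_mul]
  ring

theorem KillingEq.dl_proj_eq (hP : CompleteOrthogonalIdempotents P) (hg : IsBlockDiag P g)
    (hDg : ∀ z, IsBlockDiag P (Dg z)) (hsymm : ∀ x y, g x y = g y x)
    (hnondeg : ∀ x, (∀ y, g x y = 0) → x = 0)
    (h : KillingEq g Dg (blockScalar P l) (fun x => blockScalar P fun i => dl i x) t) (i : ι)
    (x : V) :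
    dl i (P i x) = g t (P i x) := by
  have hcyc (x y z : V) := h (P i x) (P i y) (P i z)
  simp only [bracketForm_proj_proj hP hDg, sub_self, zero_mul, zero_sub] at hcyc
  have hzero := eq_zero_or_of_cyclic_sum_eq_zero (α := fun x => dl i (P i x) - g t (P i x))
    (b := fun x y => g (P i x) (P i y)) (fun x y => hsymm _ _)
    (fun x y z => by linear_combination -hcyc x y z) x
  refine hzero.elim sub_eq_zero.1 fun hx => ?_
  have hx0 : P i x = 0 := hnondeg _ fun y => by rw [← hg.proj_proj_self hP]; exact hx y
  rw [hx0, map_zero, map_zero]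

theorem KillingEq.off_diagonal (hP : CompleteOrthogonalIdempotents P) (hg : IsBlockDiag P g)
    (hDg : ∀ z, IsBlockDiag P (Dg z))
    (h : KillingEq g Dg (blockScalar P l) (fun x => blockScalar P fun i => dl i x) t) {i j : ι}
    (hij : i ≠ j) (x y z : V) :
    (l j - l i) * Dg (P i x) (P j y) z = (dl j (P i x) - g t (P i x)) * g (P j y) z := by
  have hcyc := h (P i x) (P j y) (P j z)
  simp only [bracketForm_proj_proj hP hDg, (hDg _).proj_proj_of_ne hP hij,
    (hDg _).proj_proj_of_ne hP hij.symm, hg.proj_proj_of_ne hP hij,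
    hg.proj_proj_of_ne hP hij.symm, (hDg _).proj_proj_self hP, hg.proj_proj_self hP] at hcyc
  linear_combination hcyc

theorem bracketForm_eq_of_blocks (hP : CompleteOrthogonalIdempotents P)
    (hDg : ∀ z, IsBlockDiag P (Dg z))
    (hoff : ∀ i j x y z, (l j - l i) * Dg (P i x) (P j y) z =
      (dl j (P i x) - dl i (P i x)) * g (P j y) z)
    (hdiag : ∀ i x, dl i (P i x) = g t (P i x)) (x y z : V) :
    bracketForm g Dg (blockScalar P l) (fun x => blockScalar P fun i => dl i x) x y z =
      -(g t x * g y z) := by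
  have hblock (i j : ι) :
      bracketForm g Dg (blockScalar P l) (fun x => blockScalar P fun i => dl i x) (P i x) (P j y)
        z = -(g t (P i x) * g (P j y) z) := by
    rw [bracketForm_proj_proj hP hDg, hoff, hdiag]
    ring
  have hleft := bracketForm_sum_left (g := g) (Dg := Dg) (blockScalar P l)
    (blockScalar P ∘ₗ LinearMap.pi fun i => (dl i).toLinearMap) (fun i => P i x) y z
  rw [sum_proj_apply hP] at hleft
  have hmiddle (i : ι) := bracketForm_sum_middle (g := g) (Dg := Dg) (blockScalar P l)
    (fun x => blockScalar P fun i => dl i x) (P i x) (fun j => P j y) z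
  simp only [sum_proj_apply hP, hblock] at hmiddle
  have hgt : ∑ i, g t (P i x) = g t x := by rw [← map_sum, sum_proj_apply hP]
  have hgy : ∑ j, g (P j y) z = g y z := by
    rw [← sum_apply, ← map_sum, sum_proj_apply hP]
  refine hleft.trans ((Finset.sum_congr rfl fun i _ => hmiddle i).trans ?_)
  simp only [Finset.sum_neg_distrib, ← Finset.sum_mul_sum, hgt, hgy]

theorem killingEq_blockScalar_iff (hP : CompleteOrthogonalIdempotents P) (hg : IsBlockDiag P g)
    (hDg : ∀ z, IsBlockDiag P (Dg z)) (hsymm : ∀ x y, g x y = g y x)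
    (hnondeg : ∀ x, (∀ y, g x y = 0) → x = 0) :
    KillingEq g Dg (blockScalar P l) (fun x => blockScalar P fun i => dl i x) t ↔
      (∀ i j x y z, (l j - l i) * Dg (P i x) (P j y) z =
        (dl j (P i x) - dl i (P i x)) * g (P j y) z) ∧
      ∀ i x, dl i (P i x) = g t (P i x) := by
  refine ⟨fun h => ?_, fun ⟨hoff, hdiag⟩ x y z => ?_⟩
  · have hdiag := h.dl_proj_eq hP hg hDg hsymm hnondeg
    refine ⟨fun i j x y z => ?_, hdiag⟩
    rcases eq_or_ne i j with rfl | hij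
    · simp
    · rw [hdiag i, h.off_diagonal hP hg hDg hij]
  · simp only [bracketForm_eq_of_blocks hP hDg hoff hdiag]
    ring

theorem block_equations_iff_umbilic [DecidableEq ι] (hP : CompleteOrthogonalIdempotents P)
    (hl : Function.Injective l) :
    (∀ i j x y z, (l j - l i) * Dg (P i x) (P j y) z =
        (dl j (P i x) - dl i (P i x)) * g (P j y) z) ↔
      ∀ j v x y, -(1 / 2 : ℝ) * Dg (v - P j v) (P j x) y = g (P j x) y *
        (-(1 / 2) * ∑ i ∈ Finset.univ.erase j, (l j - l i)⁻¹ * (dl j - dl i) (P i v)) := by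
  have hne {i j : ι} (hij : i ≠ j) : l j - l i ≠ 0 := sub_ne_zero.2 (hl.ne hij.symm)
  refine ⟨fun h j v x y => ?_, fun h i j x y z => ?_⟩
  · rw [sub_proj_eq_sum_erase hP, map_sum, sum_apply,
      sum_apply, mul_left_comm]
    simp only [Finset.mul_sum]
    refine Finset.sum_congr rfl fun i hi => ?_
    rw [mul_left_comm (g (P j x) y), sub_apply, mul_comm (g (P j x) y), ← h,
      inv_mul_cancel_left₀ (hne (Finset.ne_of_mem_erase hi))]
  · rcases eq_or_ne i j with rfl | hij
    · simp
    have hij' := h j (P i x) y z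
    rw [proj_proj_of_ne hP hij.symm, sub_zero, Finset.sum_eq_single i
      (fun k _ hk => by rw [proj_proj_of_ne hP hk, map_zero, mul_zero])
      (fun hi => absurd (Finset.mem_erase.2 ⟨hij, Finset.mem_univ i⟩) hi), proj_proj_self hP,
      sub_apply] at hij'
    field_simp [hne hij] at hij'
    linear_combination -hij'

end BlockAlgebra

noncomputable section Parametrization

variable {E M V : Type*} [NormedAddCommGroup E] [NormedSpace ℝ E]
  [TopologicalSpace M] [ChartedSpace E M] [NormedAddCommGroup V] [NormedSpace ℝ V]

variable (E) in
/-- A local parametrization of `M` by an open subset of the vector space `V`: the inverse of a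
chart with values in `V` that need not belong to the atlas. -/
structure IsParametrization (φ : OpenPartialHomeomorph V M) : Prop where
  contMDiffOn : ContMDiffOn 𝓘(ℝ, V) 𝓘(ℝ, E) ∞ φ φ.source
  contMDiffOn_symm : ContMDiffOn 𝓘(ℝ, E) 𝓘(ℝ, V) ∞ φ.symm φ.target

/-- The derivative of a parametrization at `u`, as a map defined on `V` itself rather than on its
tangent space at `u`. -/
def push (φ : OpenPartialHomeomorph V M) (u : V) : V →L[ℝ] TangentSpace 𝓘(ℝ, E) (φ u) :=
  (mfderiv 𝓘(ℝ, V) 𝓘(ℝ, E) φ u).comp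
    (NormedSpace.fromTangentSpace (𝕜 := ℝ) u).symm.toContinuousLinearMap

/-- The expression of a vector field in a parametrization. -/
def pull (φ : OpenPartialHomeomorph V M) (X : ∀ p : M, TangentSpace 𝓘(ℝ, E) p) (u : V) : V :=
  (push φ u).inverse (X (φ u))

/-- The vector field with expression `F` in a parametrization; it is meaningful on the range of the
parametrization only. -/
def pushField (φ : OpenPartialHomeomorph V M) (F : V → V) (q : M) : TangentSpace 𝓘(ℝ, E) q :=
  VectorField.mpullback 𝓘(ℝ, E) 𝓘(ℝ, V) φ.symm F q

namespace IsParametrization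

variable {φ : OpenPartialHomeomorph V M} {u : V}

theorem mdifferentiable (hφ : IsParametrization E φ) : φ.MDifferentiable 𝓘(ℝ, V) 𝓘(ℝ, E) :=
  ⟨hφ.contMDiffOn.mdifferentiableOn (by simp), hφ.contMDiffOn_symm.mdifferentiableOn (by simp)⟩

theorem contMDiffAt (hφ : IsParametrization E φ) (hu : u ∈ φ.source) :
    ContMDiffAt 𝓘(ℝ, V) 𝓘(ℝ, E) ∞ φ u :=
  hφ.contMDiffOn.contMDiffAt (φ.open_source.mem_nhds hu)

theorem contMDiffAt_symm (hφ : IsParametrization E φ) {p : M} (hp : p ∈ φ.target) :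
    ContMDiffAt 𝓘(ℝ, E) 𝓘(ℝ, V) ∞ φ.symm p :=
  hφ.contMDiffOn_symm.contMDiffAt (φ.open_target.mem_nhds hp)

theorem isInvertible_mfderiv (hφ : IsParametrization E φ) (hu : u ∈ φ.source) :
    (mfderiv 𝓘(ℝ, V) 𝓘(ℝ, E) φ u).IsInvertible :=
  ⟨hφ.mdifferentiable.mfderiv hu, rfl⟩

theorem isInvertible_mfderiv_symm (hφ : IsParametrization E φ) (hu : u ∈ φ.source) :
    (mfderiv 𝓘(ℝ, E) 𝓘(ℝ, V) φ.symm (φ u)).IsInvertible :=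
  ⟨hφ.mdifferentiable.symm.mfderiv (φ.map_source hu), rfl⟩

theorem isInvertible_push (hφ : IsParametrization E φ) (hu : u ∈ φ.source) :
    (push (E := E) φ u).IsInvertible :=
  (hφ.isInvertible_mfderiv hu).comp ContinuousLinearMap.isInvertible_equiv

theorem push_injective (hφ : IsParametrization E φ) (hu : u ∈ φ.source) :
    Function.Injective (push (E := E) φ u) :=
  (hφ.isInvertible_push hu).injective

theorem push_surjective (hφ : IsParametrization E φ) (hu : u ∈ φ.source) :
    Function.Surjective (push (E := E) φ u) :=
  (hφ.isInvertible_push hu).surjective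

theorem push_pull (hφ : IsParametrization E φ) (hu : u ∈ φ.source)
    (X : ∀ p : M, TangentSpace 𝓘(ℝ, E) p) : push φ u (pull φ X u) = X (φ u) :=
  (hφ.isInvertible_push hu).self_apply_inverse _

theorem pull_eq_iff (hφ : IsParametrization E φ) (hu : u ∈ φ.source)
    {X : ∀ p : M, TangentSpace 𝓘(ℝ, E) p} {v : V} : pull φ X u = v ↔ X (φ u) = push φ u v := by
  rw [← hφ.push_pull hu X, (hφ.push_injective hu).eq_iff]

theorem pushField_apply (hφ : IsParametrization E φ) (hu : u ∈ φ.source) (F : V → V) :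
    pushField (E := E) φ F (φ u) = push φ u (F u) := by
  apply (hφ.isInvertible_mfderiv_symm hu).injective
  have hcomp := DFunLike.congr_fun (hφ.mdifferentiable.symm_comp_deriv hu)
    ((NormedSpace.fromTangentSpace (𝕜 := ℝ) u).symm (F u))
  refine ((hφ.isInvertible_mfderiv_symm hu).self_apply_inverse _).trans
    (Eq.trans ?_ hcomp.symm)
  exact congrArg F (φ.left_inv hu)

theorem diff_push (hφ : IsParametrization E φ) (hu : u ∈ φ.source) {f : M → ℝ}
    (hf : DifferentiableAt ℝ (fun w => f (φ w)) u) (v : V) :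
    diff f (φ u) (push (E := E) φ u v) = fderiv ℝ (fun w => f (φ w)) u v := by
  have hf' : MDifferentiableAt 𝓘(ℝ, E) 𝓘(ℝ, ℝ) f (φ u) := by
    have hcomp : MDifferentiableAt 𝓘(ℝ, V) 𝓘(ℝ, ℝ) (fun w => f (φ w)) (φ.symm (φ u)) := by
      rw [φ.left_inv hu]
      exact hf.mdifferentiableAt
    refine (hcomp.comp (φ u) ((hφ.contMDiffAt_symm (φ.map_source hu)).mdifferentiableAt
      (by simp))).congr_of_eventuallyEq ?_
    filter_upwards [φ.open_target.mem_nhds (φ.map_source hu)] with q hq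
    rw [Function.comp_apply, φ.right_inv hq]
  have hchain := mvfderiv_comp_apply u hf' ((hφ.contMDiffAt hu).mdifferentiableAt (by simp))
    ((NormedSpace.fromTangentSpace (𝕜 := ℝ) u).symm v)
  refine hchain.symm.trans ?_
  simp only [mvfderiv, mfderiv_eq_fderiv]
  rfl

theorem contDiffAt_comp (hφ : IsParametrization E φ) (hu : u ∈ φ.source) {f : M → ℝ}
    (hf : ContMDiffAt 𝓘(ℝ, E) 𝓘(ℝ, ℝ) ∞ f (φ u)) : ContDiffAt ℝ ∞ (fun w => f (φ w)) u :=
  (hf.comp u (hφ.contMDiffAt hu)).contDiffAt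

end IsParametrization

/-- Smoothness of a vector field at a point. -/
abbrev SmoothFieldAt [IsManifold 𝓘(ℝ, E) ∞ M] (X : ∀ p : M, TangentSpace 𝓘(ℝ, E) p) (p : M) :
    Prop :=
  ContMDiffAt 𝓘(ℝ, E) (𝓘(ℝ, E).prod 𝓘(ℝ, E)) ∞
    (fun p => (Bundle.TotalSpace.mk' E p (X p) : TangentBundle 𝓘(ℝ, E) M)) p

namespace IsParametrization

variable [IsManifold 𝓘(ℝ, E) ∞ M] {φ : OpenPartialHomeomorph V M} {u : V}
  {X Y : ∀ p : M, TangentSpace 𝓘(ℝ, E) p}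

theorem smoothFieldAt_pushField [CompleteSpace E] (hφ : IsParametrization E φ)
    (hu : u ∈ φ.source) {F : V → V} (hF : ContDiffAt ℝ ∞ F u) :
    SmoothFieldAt (pushField (E := E) φ F) (φ u) := by
  have : IsManifold 𝓘(ℝ, E) 1 M := IsManifold.of_le (n := ∞) (by simp)
  refine ContMDiffAt.mpullback_vectorField_preimage (n := ∞) (I := 𝓘(ℝ, E)) (I' := 𝓘(ℝ, V))
    (V := F) ?_ (hφ.contMDiffAt_symm (φ.map_source hu)) (hφ.isInvertible_mfderiv_symm hu) (by simp)
  rw [φ.left_inv hu]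
  exact contMDiffAt_vectorSpace_iff_contDiffAt.2 hF

variable [CompleteSpace V]

theorem contDiffAt_pull (hφ : IsParametrization E φ) (hu : u ∈ φ.source)
    (hX : SmoothFieldAt X (φ u)) : ContDiffAt ℝ ∞ (pull φ X) u := by
  have : IsManifold 𝓘(ℝ, E) 1 M := IsManifold.of_le (n := ∞) (by simp)
  have hpull := ContMDiffAt.mpullback_vectorField_preimage (n := ∞) (m := ∞) hX
    (hφ.contMDiffAt hu) (hφ.isInvertible_mfderiv hu) (by simp)
  exact contMDiffAt_vectorSpace_iff_contDiffAt.1 hpull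

theorem differentiableAt_pull (hφ : IsParametrization E φ) (hu : u ∈ φ.source)
    (hX : SmoothFieldAt X (φ u)) : DifferentiableAt ℝ (pull φ X) u :=
  (hφ.contDiffAt_pull hu hX).differentiableAt (by simp)

theorem pull_mlieBracket (hφ : IsParametrization E φ) (hu : u ∈ φ.source)
    (hX : SmoothFieldAt X (φ u)) (hY : SmoothFieldAt Y (φ u)) :
    pull φ (VectorField.mlieBracket 𝓘(ℝ, E) X Y) u =
      fderiv ℝ (pull φ Y) u (pull φ X u) - fderiv ℝ (pull φ X) u (pull φ Y u) := by
  have : IsManifold 𝓘(ℝ, E) (minSmoothness ℝ 3) M := by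
    rw [minSmoothness_of_isRCLikeNormedField]
    exact IsManifold.of_le (n := ∞) (WithTop.coe_le_coe.2 (le_top : (3 : ℕ∞) ≤ ⊤))
  have hbracket := VectorField.mpullback_mlieBracket (hX.mdifferentiableAt (by simp))
    (hY.mdifferentiableAt (by simp)) (hφ.contMDiffAt hu)
    (by
      rw [minSmoothness_of_isRCLikeNormedField]
      exact WithTop.coe_le_coe.2 (le_top : (2 : ℕ∞) ≤ ⊤))
  rw [← VectorField.mlieBracketWithin_univ (I := 𝓘(ℝ, V)),
    VectorField.mlieBracketWithin_eq_lieBracketWithin] at hbracket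
  exact hbracket.trans
    (congrFun (VectorField.lieBracketWithin_univ (V := pull φ X) (W := pull φ Y)) u)

end IsParametrization

end Parametrization

section BilinearFields

variable {V : Type*} [NormedAddCommGroup V] [NormedSpace ℝ V] {B : V → V →L[ℝ] V →L[ℝ] ℝ} {u : V}

theorem fderiv_bilin_apply (hB : DifferentiableAt ℝ B u) {F G : V → V}
    (hF : DifferentiableAt ℝ F u) (hG : DifferentiableAt ℝ G u) (v : V) :
    fderiv ℝ (fun w => B w (F w) (G w)) u v = fderiv ℝ B u v (F u) (G u)
      + B u (fderiv ℝ F u v) (G u) + B u (F u) (fderiv ℝ G u v) := by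
  rw [((hB.hasFDerivAt.clm_apply hF.hasFDerivAt).clm_apply hG.hasFDerivAt).fderiv]
  simp only [add_apply, ContinuousLinearMap.comp_apply, ContinuousLinearMap.flip_apply]
  ring

theorem fderiv_bilin_const (hB : DifferentiableAt ℝ B u) (v x y : V) :
    fderiv ℝ B u v x y = fderiv ℝ (fun w => B w x y) u v := by
  simp [fderiv_bilin_apply hB (differentiableAt_const x) (differentiableAt_const y)]

theorem fderiv_bilin_symm (hB : DifferentiableAt ℝ B u) (hsymm : ∀ w x y, B w x y = B w y x)
    (v x y : V) : fderiv ℝ B u v x y = fderiv ℝ B u v y x := by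
  simp_rw [fderiv_bilin_const hB, hsymm _ x y]

/-- The Christoffel symbols of the first kind, in terms of the derivative of the metric in a
chart. -/
noncomputable def christoffel (Dg : V → V →L[ℝ] V →L[ℝ] ℝ) (x y z : V) : ℝ :=
  1 / 2 * (Dg x y z + Dg y x z - Dg z x y)

end BilinearFields

noncomputable section PullbackMetric

variable {E M V : Type*} [NormedAddCommGroup E] [NormedSpace ℝ E]
  [TopologicalSpace M] [ChartedSpace E M] [IsManifold 𝓘(ℝ, E) ∞ M]
  [NormedAddCommGroup V] [NormedSpace ℝ V]

theorem Metric.contMDiffAt_val (g : Metric E M) {p : M} {X Y : ∀ p : M, TangentSpace 𝓘(ℝ, E) p}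
    (hX : SmoothFieldAt X p) (hY : SmoothFieldAt Y p) :
    ContMDiffAt 𝓘(ℝ, E) 𝓘(ℝ, ℝ) ∞ (fun q => g.val q (X q) (Y q)) p := by
  have h := ContMDiffAt.clm_bundle_apply₂ (F₁ := E) (F₂ := E) (F₃ := ℝ)
    (E₃ := Bundle.Trivial M ℝ) (b := fun q : M => q) (ψ := g.val) g.contMDiff.contMDiffAt hX hY
  exact (Bundle.contMDiffAt_totalSpace.1 h).2

theorem Metric.contMDiffAt_lower (g : Metric E M) {p : M} {X : ∀ p : M, TangentSpace 𝓘(ℝ, E) p}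
    (hX : SmoothFieldAt X p) :
    ContMDiffAt 𝓘(ℝ, E) (𝓘(ℝ, E).prod 𝓘(ℝ, E →L[ℝ] ℝ)) ∞
      (fun q => Bundle.TotalSpace.mk' (E →L[ℝ] ℝ) q (g.val q (X q))) p :=
  ContMDiffAt.clm_bundle_apply (F₁ := E) (F₂ := E →L[ℝ] ℝ)
    (E₂ := fun q : M => TangentSpace 𝓘(ℝ, E) q →L[ℝ] ℝ) (b := fun q : M => q) (ϕ := g.val)
    g.contMDiff.contMDiffAt hX

/-- The expression of a metric in a parametrization. -/
def Metric.pullback (g : Metric E M) (φ : OpenPartialHomeomorph V M) (u : V) :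
    V →L[ℝ] V →L[ℝ] ℝ :=
  (ContinuousLinearMap.precomp ℝ (push φ u)).comp ((g.val (φ u)).comp (push φ u))

variable {φ : OpenPartialHomeomorph V M} {u : V} {X Y Z : ∀ p : M, TangentSpace 𝓘(ℝ, E) p}

theorem Metric.pullback_apply (g : Metric E M) (φ : OpenPartialHomeomorph V M) (u v w : V) :
    g.pullback φ u v w = g.val (φ u) (push φ u v) (push φ u w) :=
  rfl

theorem Metric.pullback_symm (g : Metric E M) (φ : OpenPartialHomeomorph V M) (u v w : V) :
    g.pullback φ u v w = g.pullback φ u w v :=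
  g.symm _ _ _

theorem Metric.pullback_pull (g : Metric E M) (hφ : IsParametrization E φ) (hu : u ∈ φ.source)
    (X Y : ∀ p : M, TangentSpace 𝓘(ℝ, E) p) :
    g.pullback φ u (pull φ X u) (pull φ Y u) = g.val (φ u) (X (φ u)) (Y (φ u)) := by
  rw [g.pullback_apply, hφ.push_pull hu, hφ.push_pull hu]

theorem Metric.pullback_nondegenerate (g : Metric E M) (hφ : IsParametrization E φ)
    (hu : u ∈ φ.source) (v : V) (h : ∀ w, g.pullback φ u v w = 0) : v = 0 := by
  refine hφ.push_injective hu ((g.nondegenerate _ _ fun w => ?_).trans (map_zero _).symm)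
  obtain ⟨w, rfl⟩ := hφ.push_surjective hu w
  exact h w

variable [FiniteDimensional ℝ V]

theorem Metric.isInvertible_pullback (g : Metric E M) (hφ : IsParametrization E φ)
    (hu : u ∈ φ.source) : (g.pullback φ u).IsInvertible := by
  have hinj : Function.Injective ((ContinuousLinearMap.coeLM ℝ).comp
      (g.pullback φ u).toLinearMap : V →ₗ[ℝ] Module.Dual ℝ V) :=
    (injective_iff_map_eq_zero _).2 fun v hv =>
      g.pullback_nondegenerate hφ hu v fun w => LinearMap.congr_fun hv w
  have hsurj := (LinearMap.injective_iff_surjective_of_finrank_eq_finrank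
    Subspace.dual_finrank_eq.symm).1 hinj
  have hbij : Function.Bijective (g.pullback φ u).toLinearMap := by
    refine ⟨fun v w hvw => hinj (congrArg (ContinuousLinearMap.coeLM ℝ) hvw), fun α => ?_⟩
    obtain ⟨v, hv⟩ := hsurj α.toLinearMap
    exact ⟨v, ContinuousLinearMap.ext fun w => LinearMap.congr_fun hv w⟩
  exact ⟨(LinearEquiv.ofBijective _ hbij).toContinuousLinearEquiv, rfl⟩

variable [FiniteDimensional ℝ E]

theorem Metric.contDiffAt_pullback (g : Metric E M) (hφ : IsParametrization E φ)
    (hu : u ∈ φ.source) : ContDiffAt ℝ ∞ (g.pullback φ) u := by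
  have := FiniteDimensional.complete ℝ E
  suffices h : ContDiffOn ℝ ∞ (g.pullback φ) φ.source from h.contDiffAt (φ.open_source.mem_nhds hu)
  refine contDiffOn_clm_apply.2 fun v => contDiffOn_clm_apply.2 fun w z hz =>
    ContDiffAt.contDiffWithinAt ?_
  have hval := g.contMDiffAt_val (hφ.smoothFieldAt_pushField hz (contDiffAt_const (c := v)))
    (hφ.smoothFieldAt_pushField hz (contDiffAt_const (c := w)))
  refine (hφ.contDiffAt_comp hz hval).congr_of_eventuallyEq ?_
  filter_upwards [φ.open_source.mem_nhds hz] with y hy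
  rw [g.pullback_apply, hφ.pushField_apply hy, hφ.pushField_apply hy]

theorem Metric.differentiableAt_pullback (g : Metric E M) (hφ : IsParametrization E φ)
    (hu : u ∈ φ.source) : DifferentiableAt ℝ (g.pullback φ) u :=
  (g.contDiffAt_pullback hφ hu).differentiableAt (by simp)

theorem Metric.diff_val_push (g : Metric E M) (hφ : IsParametrization E φ) (hu : u ∈ φ.source)
    (hX : SmoothFieldAt X (φ u)) (hY : SmoothFieldAt Y (φ u)) (v : V) :
    diff (fun q => g.val q (X q) (Y q)) (φ u) (push (E := E) φ u v) =
      fderiv ℝ (g.pullback φ) u v (pull φ X u) (pull φ Y u)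
      + g.pullback φ u (fderiv ℝ (pull φ X) u v) (pull φ Y u)
      + g.pullback φ u (pull φ X u) (fderiv ℝ (pull φ Y) u v) := by
  have := FiniteDimensional.complete ℝ V
  rw [hφ.diff_push hu ((hφ.contDiffAt_comp hu (g.contMDiffAt_val hX hY)).differentiableAt
    (by simp)), ← fderiv_bilin_apply (g.differentiableAt_pullback hφ hu)
    (hφ.differentiableAt_pull hu hX) (hφ.differentiableAt_pull hu hY)]
  refine DFunLike.congr_fun (Filter.EventuallyEq.fderiv_eq ?_) v
  filter_upwards [φ.open_source.mem_nhds hu] with w hw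
  rw [g.pullback_pull hφ hw]

theorem Metric.koszul_eq (g : Metric E M) (hφ : IsParametrization E φ) (hu : u ∈ φ.source)
    (hX : SmoothFieldAt X (φ u)) (hY : SmoothFieldAt Y (φ u)) (hZ : SmoothFieldAt Z (φ u)) :
    g.koszul X Y Z (φ u) =
      2 * (christoffel (fderiv ℝ (g.pullback φ) u) (pull φ X u) (pull φ Y u) (pull φ Z u)
        + g.pullback φ u (fderiv ℝ (pull φ Y) u (pull φ X u)) (pull φ Z u)) := by
  have := FiniteDimensional.complete ℝ V
  have hdiff {X Y : ∀ p : M, TangentSpace 𝓘(ℝ, E) p} (hX : SmoothFieldAt X (φ u))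
      (hY : SmoothFieldAt Y (φ u)) (Z : ∀ p : M, TangentSpace 𝓘(ℝ, E) p) :=
    hφ.push_pull hu Z ▸ g.diff_val_push hφ hu hX hY (pull φ Z u)
  unfold Metric.koszul christoffel
  rw [hdiff hY hZ, hdiff hX hZ, hdiff hX hY]
  simp only [← g.pullback_pull hφ hu, hφ.pull_mlieBracket hu hX hY, hφ.pull_mlieBracket hu hX hZ,
    hφ.pull_mlieBracket hu hY hZ, map_sub, sub_apply]
  rw [g.pullback_symm φ u (pull φ Y u) (fderiv ℝ (pull φ Z) u (pull φ X u)),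
    g.pullback_symm φ u (pull φ X u) (fderiv ℝ (pull φ Z) u (pull φ Y u)),
    g.pullback_symm φ u (pull φ X u) (fderiv ℝ (pull φ Y) u (pull φ Z u))]
  ring

theorem Metric.val_leviCivita (g : Metric E M) (hφ : IsParametrization E φ) (hu : u ∈ φ.source)
    (hX : SmoothFieldAt X (φ u)) (hY : SmoothFieldAt Y (φ u)) (v : V) :
    g.val (φ u) (g.leviCivita X Y (φ u)) (push φ u v) =
      christoffel (fderiv ℝ (g.pullback φ) u) (pull φ X u) (pull φ Y u) v
      + g.pullback φ u (fderiv ℝ (pull φ Y) u (pull φ X u)) v := by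
  let A : V →L[ℝ] ℝ := (1 / 2 : ℝ) • (fderiv ℝ (g.pullback φ) u (pull φ X u) (pull φ Y u)
        + fderiv ℝ (g.pullback φ) u (pull φ Y u) (pull φ X u)
        - ((fderiv ℝ (g.pullback φ) u).flip (pull φ X u)).flip (pull φ Y u))
      + g.pullback φ u (fderiv ℝ (pull φ Y) u (pull φ X u))
  have hA (w : V) : A w = christoffel (fderiv ℝ (g.pullback φ) u) (pull φ X u) (pull φ Y u) w
      + g.pullback φ u (fderiv ℝ (pull φ Y) u (pull φ X u)) w := rfl
  have hconstr : ((Module.finBasis ℝ (TangentSpace 𝓘(ℝ, E) (φ u))).constr ℝ fun a =>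
      (1 / 2 : ℝ) * g.koszul X Y (FiberBundle.extend E
        (Module.finBasis ℝ (TangentSpace 𝓘(ℝ, E) (φ u)) a)) (φ u)) =
      (A.comp (push (E := E) φ u).inverse).toLinearMap := by
    refine (Module.finBasis ℝ (TangentSpace 𝓘(ℝ, E) (φ u))).ext fun a => ?_
    set e := Module.finBasis ℝ (TangentSpace 𝓘(ℝ, E) (φ u)) a
    have he : (push (E := E) φ u).inverse e = pull φ (FiberBundle.extend E e) u := by
      rw [pull, FiberBundle.extend_apply_self]
    rw [Module.Basis.constr_basis,
      g.koszul_eq hφ hu hX hY (FiberBundle.contMDiffAt_extend _ _ _), ContinuousLinearMap.coe_coe,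
      ContinuousLinearMap.comp_apply, he, hA]
    ring
  rw [Metric.leviCivita, g.val_sharp, hconstr, ContinuousLinearMap.coe_coe,
    ContinuousLinearMap.comp_apply, (hφ.isInvertible_push hu).inverse_apply_self, hA]

end PullbackMetric

noncomputable section Gradients

variable {E M V : Type*} [NormedAddCommGroup E] [NormedSpace ℝ E]
  [TopologicalSpace M] [ChartedSpace E M] [NormedAddCommGroup V] [NormedSpace ℝ V]
  {φ : OpenPartialHomeomorph V M} {u : V} {f : M → ℝ}

/-- The matrix of second derivatives of a function in a parametrization. Unlike the Hessian of the
Levi-Civita connection, it depends on the parametrization. -/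
def coordHessian (φ : OpenPartialHomeomorph V M) (f : M → ℝ) (u : V) : V →L[ℝ] V →L[ℝ] ℝ :=
  fderiv ℝ (fderiv ℝ fun w => f (φ w)) u

namespace IsParametrization

theorem differentiableAt_comp (hφ : IsParametrization E φ) (hu : u ∈ φ.source)
    (hf : ContMDiff 𝓘(ℝ, E) 𝓘(ℝ, ℝ) ∞ f) : DifferentiableAt ℝ (fun w => f (φ w)) u :=
  (hφ.contDiffAt_comp hu hf.contMDiffAt).differentiableAt (by simp)

theorem hasFDerivAt_fderiv_comp (hφ : IsParametrization E φ) (hu : u ∈ φ.source)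
    (hf : ContMDiff 𝓘(ℝ, E) 𝓘(ℝ, ℝ) ∞ f) :
    HasFDerivAt (fderiv ℝ fun w => f (φ w)) (coordHessian φ f u) u :=
  (((hφ.contDiffAt_comp hu hf.contMDiffAt).fderiv_right (m := 1)
    (WithTop.coe_le_coe.2 (le_top : (1 + 1 : ℕ∞) ≤ ⊤))).differentiableAt one_ne_zero).hasFDerivAt

theorem coordHessian_symm (hφ : IsParametrization E φ) (hu : u ∈ φ.source)
    (hf : ContMDiff 𝓘(ℝ, E) 𝓘(ℝ, ℝ) ∞ f) (v w : V) :
    coordHessian φ f u v w = coordHessian φ f u w v :=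
  (hφ.contDiffAt_comp hu hf.contMDiffAt).isSymmSndFDerivAt (by
    rw [minSmoothness_of_isRCLikeNormedField]
    exact WithTop.coe_le_coe.2 (le_top : (2 : ℕ∞) ≤ ⊤)) v w

end IsParametrization

variable [FiniteDimensional ℝ E]

/-- A bump function extends `α`, read in the parametrization, to all of `M`. -/
theorem IsParametrization.exists_fderiv_eq [IsManifold 𝓘(ℝ, E) ∞ M] [T2Space M]
    (hφ : IsParametrization E φ) (hu : u ∈ φ.source) (α : V →L[ℝ] ℝ) :
    ∃ f : M → ℝ, ContMDiff 𝓘(ℝ, E) 𝓘(ℝ, ℝ) ∞ f ∧ fderiv ℝ (fun w => f (φ w)) u = α := by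
  obtain ⟨ψ, -, hψ⟩ := (SmoothBumpFunction.nhds_basis_tsupport (I := 𝓘(ℝ, E)) (φ u)).mem_iff.1
    (φ.open_target.mem_nhds (φ.map_source hu))
  refine ⟨fun q => ψ q * α (φ.symm q), contMDiff_of_tsupport fun q hq => ?_, ?_⟩
  · have hq' : q ∈ φ.target := hψ (closure_mono (fun z hz => left_ne_zero_of_mul hz) hq)
    exact ψ.contMDiff.contMDiffAt.mul
      (α.contDiff.contDiffAt.contMDiffAt.comp q (hφ.contMDiffAt_symm hq'))
  · have hα : (fun w => ψ (φ w) * α (φ.symm (φ w))) =ᶠ[nhds u] α := by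
      filter_upwards [φ.open_source.mem_nhds hu,
        (φ.continuousAt hu).eventually ψ.eventuallyEq_one] with w hw hψw
      rw [hψw, φ.left_inv hw, Pi.one_apply, one_mul]
    rw [hα.fderiv_eq, α.fderiv]

variable [IsManifold 𝓘(ℝ, E) ∞ M] (g : Metric E M)

theorem Metric.val_grad (f : M → ℝ) (p : M) : g.val p (g.grad f p) = diff f p :=
  ContinuousLinearMap.ext (g.val_sharp p _)

theorem Metric.pullback_pull_grad (hφ : IsParametrization E φ) (hu : u ∈ φ.source)
    (hf : DifferentiableAt ℝ (fun w => f (φ w)) u) :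
    g.pullback φ u (pull φ (g.grad f) u) = fderiv ℝ (fun w => f (φ w)) u := by
  ext v
  rw [g.pullback_apply, hφ.push_pull hu, g.val_grad, hφ.diff_push hu hf]

variable [FiniteDimensional ℝ V]

theorem Metric.differentiableAt_inverse_pullback (hφ : IsParametrization E φ)
    (hu : u ∈ φ.source) : DifferentiableAt ℝ (fun w => (g.pullback φ w).inverse) u := by
  have := FiniteDimensional.complete ℝ V
  exact (((g.isInvertible_pullback hφ hu).contDiffAt_map_inverse (n := ∞)).differentiableAt
    (by simp)).comp u (g.differentiableAt_pullback hφ hu)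

theorem Metric.differentiableAt_pull_grad (hφ : IsParametrization E φ) (hu : u ∈ φ.source)
    (hf : ContMDiff 𝓘(ℝ, E) 𝓘(ℝ, ℝ) ∞ f) : DifferentiableAt ℝ (pull φ (g.grad f)) u := by
  refine ((g.differentiableAt_inverse_pullback hφ hu).clm_apply
    (hφ.hasFDerivAt_fderiv_comp hu hf).differentiableAt).congr_of_eventuallyEq ?_
  filter_upwards [φ.open_source.mem_nhds hu] with w hw
  rw [← g.pullback_pull_grad hφ hw (hφ.differentiableAt_comp hw hf),
    (g.isInvertible_pullback hφ hw).inverse_apply_self]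

theorem Metric.pullback_fderiv_pull_grad (hφ : IsParametrization E φ) (hu : u ∈ φ.source)
    (hf : ContMDiff 𝓘(ℝ, E) 𝓘(ℝ, ℝ) ∞ f) (z v : V) :
    g.pullback φ u (fderiv ℝ (pull φ (g.grad f)) u z) v =
      coordHessian φ f u z v - fderiv ℝ (g.pullback φ) u z (pull φ (g.grad f) u) v := by
  have hgrad : (fun w => g.pullback φ w (pull φ (g.grad f) w)) =ᶠ[nhds u]
      fderiv ℝ fun w => f (φ w) := by
    filter_upwards [φ.open_source.mem_nhds hu] with w hw
    exact g.pullback_pull_grad hφ hw (hφ.differentiableAt_comp hw hf)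
  have hderiv := ((g.differentiableAt_pullback hφ hu).hasFDerivAt.clm_apply
    (g.differentiableAt_pull_grad hφ hu hf).hasFDerivAt).fderiv.symm.trans hgrad.fderiv_eq
  have hzv := DFunLike.congr_fun (DFunLike.congr_fun hderiv z) v
  simp only [add_apply, ContinuousLinearMap.comp_apply, ContinuousLinearMap.flip_apply] at hzv
  exact eq_sub_of_add_eq hzv

theorem Metric.exists_pull_grad_eq [T2Space M] (hφ : IsParametrization E φ) (hu : u ∈ φ.source)
    (x : V) : ∃ f : M → ℝ, ContMDiff 𝓘(ℝ, E) 𝓘(ℝ, ℝ) ∞ f ∧ pull φ (g.grad f) u = x := by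
  obtain ⟨f, hf, hfx⟩ := hφ.exists_fderiv_eq hu (g.pullback φ u x)
  refine ⟨f, hf, (g.isInvertible_pullback hφ hu).injective ?_⟩
  rw [g.pullback_pull_grad hφ hu (hφ.differentiableAt_comp hu hf), hfx]

variable {a b : M → ℝ} {S : V → V →L[ℝ] V}

theorem Metric.differentiableAt_pullback_grad (hφ : IsParametrization E φ) (hu : u ∈ φ.source)
    (ha : ContMDiff 𝓘(ℝ, E) 𝓘(ℝ, ℝ) ∞ a) (hb : ContMDiff 𝓘(ℝ, E) 𝓘(ℝ, ℝ) ∞ b)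
    (hS : DifferentiableAt ℝ S u) : DifferentiableAt ℝ
      (fun w => g.pullback φ w (S w (pull φ (g.grad a) w)) (pull φ (g.grad b) w)) u :=
  ((g.differentiableAt_pullback hφ hu).clm_apply
    (hS.clm_apply (g.differentiableAt_pull_grad hφ hu ha))).clm_apply
    (g.differentiableAt_pull_grad hφ hu hb)

theorem Metric.fderiv_pullback_grad (hφ : IsParametrization E φ) (hu : u ∈ φ.source)
    (ha : ContMDiff 𝓘(ℝ, E) 𝓘(ℝ, ℝ) ∞ a) (hb : ContMDiff 𝓘(ℝ, E) 𝓘(ℝ, ℝ) ∞ b)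
    (hS : DifferentiableAt ℝ S u)
    (hself : ∀ x y, g.pullback φ u (S u x) y = g.pullback φ u x (S u y)) (z : V) :
    fderiv ℝ (fun w => g.pullback φ w (S w (pull φ (g.grad a) w)) (pull φ (g.grad b) w)) u z =
      coordHessian φ a u z (S u (pull φ (g.grad b) u))
      + coordHessian φ b u z (S u (pull φ (g.grad a) u))
      + g.pullback φ u (fderiv ℝ S u z (pull φ (g.grad a) u)) (pull φ (g.grad b) u)
      - fderiv ℝ (g.pullback φ) u z (pull φ (g.grad a) u) (S u (pull φ (g.grad b) u)) := by
  have hda := g.differentiableAt_pull_grad hφ hu ha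
  have hdb := g.differentiableAt_pull_grad hφ hu hb
  rw [fderiv_bilin_apply (g.differentiableAt_pullback hφ hu) (hS.clm_apply hda) hdb,
    (hS.hasFDerivAt.clm_apply hda.hasFDerivAt).fderiv]
  simp only [add_apply, ContinuousLinearMap.comp_apply, ContinuousLinearMap.flip_apply, map_add]
  rw [hself, g.pullback_fderiv_pull_grad hφ hu ha, g.pullback_symm φ u (S u _),
    g.pullback_fderiv_pull_grad hφ hu hb,
    fderiv_bilin_symm (g.differentiableAt_pullback hφ hu) (g.pullback_symm φ) z (S u _)]
  ring

end Gradients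

noncomputable section SchoutenBracket

variable {E M V : Type*} [NormedAddCommGroup E] [NormedSpace ℝ E] [FiniteDimensional ℝ E]
  [TopologicalSpace M] [ChartedSpace E M] [IsManifold 𝓘(ℝ, E) ∞ M]
  [NormedAddCommGroup V] [NormedSpace ℝ V]
  (T : SymTensor E M) (g : Metric E M) {φ : OpenPartialHomeomorph V M} {u : V}

theorem SymTensor.val_lower (p : M) (v : TangentSpace 𝓘(ℝ, E) p)
    (β : TangentSpace 𝓘(ℝ, E) p →L[ℝ] ℝ) : T.val p (g.val p v) β = β (T.endo g p v) := by
  have hβ : g.val p (g.sharp p β.toLinearMap) = β := ContinuousLinearMap.ext (g.val_sharp p _)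
  have hendo := g.val_sharp p ((T.val p (g.val p v)).comp (g.val p).toLinearMap)
    (g.sharp p β.toLinearMap)
  rw [g.symm, hβ] at hendo
  exact (hendo.trans (congrArg (T.val p (g.val p v)) hβ)).symm

theorem SymTensor.val_diff (f : M → ℝ) (p : M) (β : TangentSpace 𝓘(ℝ, E) p →L[ℝ] ℝ) :
    T.val p (diff f p) β = β (T.endo g p (g.grad f p)) := by
  rw [← T.val_lower, g.val_grad]

theorem Metric.contra_diff (f : M → ℝ) (p : M) (β : TangentSpace 𝓘(ℝ, E) p →L[ℝ] ℝ) :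
    g.contra p (diff f p) β = β (g.grad f p) := by
  rw [Metric.contra, ← g.val_grad, g.symm, g.val_sharp]
  rfl

theorem Metric.contra_diff_diff (hφ : IsParametrization E φ) (hu : u ∈ φ.source) (a b : M → ℝ) :
    g.contra (φ u) (diff a (φ u)) (diff b (φ u)) =
      g.pullback φ u (pull φ (g.grad a) u) (pull φ (g.grad b) u) := by
  rw [g.contra_diff, ← g.val_grad, g.symm, g.pullback_pull hφ hu]

theorem Metric.contra_diff_eq_fderiv (hφ : IsParametrization E φ) (hu : u ∈ φ.source) (a : M → ℝ)
    {f : M → ℝ} (hf : DifferentiableAt ℝ (fun w => f (φ w)) u) :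
    g.contra (φ u) (diff a (φ u)) (diff f (φ u)) =
      fderiv ℝ (fun w => f (φ w)) u (pull φ (g.grad a) u) := by
  rw [g.contra_diff, ← hφ.diff_push hu hf, hφ.push_pull hu]

theorem Metric.symProd_contra (hφ : IsParametrization E φ) (hu : u ∈ φ.source)
    (t : ∀ p : M, TangentSpace 𝓘(ℝ, E) p) (f₁ f₂ f₃ : M → ℝ) :
    symProd (t (φ u)) (g.contra (φ u)) (diff f₁ (φ u)) (diff f₂ (φ u)) (diff f₃ (φ u)) =
      let G := g.pullback φ u
      let x₁ := pull φ (g.grad f₁) u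
      let x₂ := pull φ (g.grad f₂) u
      let x₃ := pull φ (g.grad f₃) u
      let τ := pull φ t u
      (1 / 3 : ℝ) * (G τ x₁ * G x₂ x₃ + G τ x₂ * G x₃ x₁ + G τ x₃ * G x₁ x₂) := by
  simp only [symProd, g.contra_diff_diff hφ hu, g.pullback_symm φ u (pull φ t u),
    g.pullback_pull hφ hu, g.val_grad]

variable [FiniteDimensional ℝ V]

/-- The expression in a parametrization of the endomorphism field of `T`. -/
def SymTensor.pullEndo (φ : OpenPartialHomeomorph V M) (u : V) : V →L[ℝ] V :=
  LinearMap.toContinuousLinearMap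
    ((push φ u).inverse.toLinearMap ∘ₗ T.endo g (φ u) ∘ₗ (push φ u).toLinearMap)

theorem SymTensor.push_pullEndo (hφ : IsParametrization E φ) (hu : u ∈ φ.source) (v : V) :
    push φ u (T.pullEndo g φ u v) = T.endo g (φ u) (push φ u v) :=
  (hφ.isInvertible_push hu).self_apply_inverse _

theorem SymTensor.pullback_pullEndo (hφ : IsParametrization E φ) (hu : u ∈ φ.source) (v w : V) :
    g.pullback φ u (T.pullEndo g φ u v) w =
      T.val (φ u) (g.val (φ u) (push φ u v)) (g.val (φ u) (push φ u w)) := by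
  rw [g.pullback_symm, g.pullback_apply, T.push_pullEndo g hφ hu, T.val_lower]

theorem SymTensor.pullback_pullEndo_comm (hφ : IsParametrization E φ) (hu : u ∈ φ.source)
    (v w : V) :
    g.pullback φ u (T.pullEndo g φ u v) w = g.pullback φ u v (T.pullEndo g φ u w) := by
  rw [g.pullback_symm φ u v, T.pullback_pullEndo g hφ hu, T.pullback_pullEndo g hφ hu, T.symm]

theorem SymTensor.contDiffAt_pullback_pullEndo (hφ : IsParametrization E φ) (hu : u ∈ φ.source)
    (v w : V) : ContDiffAt ℝ ∞ (fun z => g.pullback φ z (T.pullEndo g φ z v) w) u := by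
  have := FiniteDimensional.complete ℝ E
  have hlower (x : V) :=
    g.contMDiffAt_lower (hφ.smoothFieldAt_pushField hu (contDiffAt_const (c := x)))
  refine (hφ.contDiffAt_comp hu (T.contMDiffAt _ _ _ (hlower v)
    (hlower w))).congr_of_eventuallyEq ?_
  filter_upwards [φ.open_source.mem_nhds hu] with z hz
  rw [T.pullback_pullEndo g hφ hz, hφ.pushField_apply hz, hφ.pushField_apply hz]

theorem SymTensor.differentiableAt_pullEndo (hφ : IsParametrization E φ) (hu : u ∈ φ.source) :
    DifferentiableAt ℝ (T.pullEndo g φ) u := by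
  have hlower : DifferentiableAt ℝ (fun w => (g.pullback φ w).comp (T.pullEndo g φ w)) u := by
    suffices h : ContDiffOn ℝ ∞ (fun w => (g.pullback φ w).comp (T.pullEndo g φ w)) φ.source from
      (h.contDiffAt (φ.open_source.mem_nhds hu)).differentiableAt (by simp)
    exact contDiffOn_clm_apply.2 fun v => contDiffOn_clm_apply.2 fun w z hz =>
      (T.contDiffAt_pullback_pullEndo g hφ hz v w).contDiffWithinAt
  refine ((g.differentiableAt_inverse_pullback hφ hu).clm_comp hlower).congr_of_eventuallyEq ?_
  filter_upwards [φ.open_source.mem_nhds hu] with w hw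
  ext v
  exact ((g.isInvertible_pullback hφ hw).inverse_apply_self _).symm

theorem SymTensor.val_diff_diff (hφ : IsParametrization E φ) (hu : u ∈ φ.source) (a b : M → ℝ) :
    T.val (φ u) (diff a (φ u)) (diff b (φ u)) =
      g.pullback φ u (T.pullEndo g φ u (pull φ (g.grad a) u)) (pull φ (g.grad b) u) := by
  rw [T.pullback_pullEndo g hφ hu, hφ.push_pull hu, hφ.push_pull hu, g.val_grad, g.val_grad]

theorem SymTensor.val_diff_eq_fderiv (hφ : IsParametrization E φ) (hu : u ∈ φ.source) (a : M → ℝ)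
    {f : M → ℝ} (hf : DifferentiableAt ℝ (fun w => f (φ w)) u) :
    T.val (φ u) (diff a (φ u)) (diff f (φ u)) =
      fderiv ℝ (fun w => f (φ w)) u (T.pullEndo g φ u (pull φ (g.grad a) u)) := by
  rw [T.val_diff g, ← hφ.diff_push hu hf, T.push_pullEndo g hφ hu, hφ.push_pull hu]

variable {f₁ f₂ f₃ : M → ℝ}

/-- The terms with second derivatives cancel in the cyclic sum. -/
theorem SymTensor.val_diff_contra_sub_contra_diff_val (hφ : IsParametrization E φ)
    (hu : u ∈ φ.source) (a : M → ℝ) {b c : M → ℝ} (hb : ContMDiff 𝓘(ℝ, E) 𝓘(ℝ, ℝ) ∞ b)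
    (hc : ContMDiff 𝓘(ℝ, E) 𝓘(ℝ, ℝ) ∞ c) :
    T.val (φ u) (diff a (φ u)) (diff (fun q => g.contra q (diff b q) (diff c q)) (φ u))
      - g.contra (φ u) (diff a (φ u)) (diff (fun q => T.val q (diff b q) (diff c q)) (φ u)) =
    bracketForm (g.pullback φ u) (fderiv ℝ (g.pullback φ) u) (T.pullEndo g φ u)
      (fderiv ℝ (T.pullEndo g φ) u) (pull φ (g.grad a) u) (pull φ (g.grad b) u)
      (pull φ (g.grad c) u)
    + coordHessian φ b u (T.pullEndo g φ u (pull φ (g.grad a) u)) (pull φ (g.grad c) u)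
    + coordHessian φ c u (T.pullEndo g φ u (pull φ (g.grad a) u)) (pull φ (g.grad b) u)
    - coordHessian φ b u (pull φ (g.grad a) u) (T.pullEndo g φ u (pull φ (g.grad c) u))
    - coordHessian φ c u (pull φ (g.grad a) u) (T.pullEndo g φ u (pull φ (g.grad b) u)) := by
  have hS := T.differentiableAt_pullEndo g hφ hu
  have hid : DifferentiableAt ℝ (fun _ : V => ContinuousLinearMap.id ℝ V) u :=
    differentiableAt_const _
  have hcontra : (fun w => g.contra (φ w) (diff b (φ w)) (diff c (φ w))) =ᶠ[nhds u] fun w =>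
      g.pullback φ w (ContinuousLinearMap.id ℝ V (pull φ (g.grad b) w)) (pull φ (g.grad c) w) := by
    filter_upwards [φ.open_source.mem_nhds hu] with w hw using g.contra_diff_diff hφ hw b c
  have hval : (fun w => T.val (φ w) (diff b (φ w)) (diff c (φ w))) =ᶠ[nhds u] fun w =>
      g.pullback φ w (T.pullEndo g φ w (pull φ (g.grad b) w)) (pull φ (g.grad c) w) := by
    filter_upwards [φ.open_source.mem_nhds hu] with w hw using T.val_diff_diff g hφ hw b c
  rw [T.val_diff_eq_fderiv g hφ hu a
      ((g.differentiableAt_pullback_grad hφ hu hb hc hid).congr_of_eventuallyEq hcontra),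
    g.contra_diff_eq_fderiv hφ hu a
      ((g.differentiableAt_pullback_grad hφ hu hb hc hS).congr_of_eventuallyEq hval),
    hcontra.fderiv_eq, hval.fderiv_eq,
    g.fderiv_pullback_grad hφ hu hb hc hS (T.pullback_pullEndo_comm g hφ hu),
    g.fderiv_pullback_grad hφ hu hb hc hid fun x y => rfl, bracketForm]
  simp only [fderiv_const_apply, zero_apply, map_zero, ContinuousLinearMap.id_apply]
  ring

theorem SymTensor.schouten_eq (hφ : IsParametrization E φ) (hu : u ∈ φ.source)
    (h₁ : ContMDiff 𝓘(ℝ, E) 𝓘(ℝ, ℝ) ∞ f₁) (h₂ : ContMDiff 𝓘(ℝ, E) 𝓘(ℝ, ℝ) ∞ f₂)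
    (h₃ : ContMDiff 𝓘(ℝ, E) 𝓘(ℝ, ℝ) ∞ f₃) :
    schouten (fun q α β => T.val q α β) g.contra f₁ f₂ f₃ (φ u) =
      let B := bracketForm (g.pullback φ u) (fderiv ℝ (g.pullback φ) u) (T.pullEndo g φ u)
        (fderiv ℝ (T.pullEndo g φ) u)
      let x₁ := pull φ (g.grad f₁) u
      let x₂ := pull φ (g.grad f₂) u
      let x₃ := pull φ (g.grad f₃) u
      (2 / 3 : ℝ) * (B x₁ x₂ x₃ + B x₂ x₃ x₁ + B x₃ x₁ x₂) := by
  have h₁₂₃ := T.val_diff_contra_sub_contra_diff_val g hφ hu f₁ h₂ h₃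
  have h₂₃₁ := T.val_diff_contra_sub_contra_diff_val g hφ hu f₂ h₃ h₁
  have h₃₁₂ := T.val_diff_contra_sub_contra_diff_val g hφ hu f₃ h₁ h₂
  rw [hφ.coordHessian_symm hu h₂, hφ.coordHessian_symm hu h₃] at h₁₂₃
  rw [hφ.coordHessian_symm hu h₃, hφ.coordHessian_symm hu h₁] at h₂₃₁
  rw [hφ.coordHessian_symm hu h₁, hφ.coordHessian_symm hu h₂] at h₃₁₂
  simp only [schouten]
  linear_combination (2 / 3 : ℝ) * (h₁₂₃ + h₂₃₁ + h₃₁₂)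

theorem SymTensor.isConformalKilling_at_iff [T2Space M] (hφ : IsParametrization E φ)
    (hu : u ∈ φ.source) (t : ∀ p : M, TangentSpace 𝓘(ℝ, E) p) :
    (∀ f₁ f₂ f₃ : M → ℝ, ContMDiff 𝓘(ℝ, E) 𝓘(ℝ, ℝ) ∞ f₁ → ContMDiff 𝓘(ℝ, E) 𝓘(ℝ, ℝ) ∞ f₂ →
      ContMDiff 𝓘(ℝ, E) 𝓘(ℝ, ℝ) ∞ f₃ →
      schouten (fun q α β => T.val q α β) g.contra f₁ f₂ f₃ (φ u) = -2 * symProd (t (φ u))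
        (g.contra (φ u)) (diff f₁ (φ u)) (diff f₂ (φ u)) (diff f₃ (φ u))) ↔
      KillingEq (g.pullback φ u) (fderiv ℝ (g.pullback φ) u) (T.pullEndo g φ u)
        (fderiv ℝ (T.pullEndo g φ) u) (pull φ t u) := by
  refine ⟨fun h x y z => ?_, fun h f₁ f₂ f₃ h₁ h₂ h₃ => ?_⟩
  · obtain ⟨f₁, h₁, rfl⟩ := g.exists_pull_grad_eq hφ hu x
    obtain ⟨f₂, h₂, rfl⟩ := g.exists_pull_grad_eq hφ hu y
    obtain ⟨f₃, h₃, rfl⟩ := g.exists_pull_grad_eq hφ hu z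
    have h₁₂₃ := h f₁ f₂ f₃ h₁ h₂ h₃
    rw [T.schouten_eq g hφ hu h₁ h₂ h₃, g.symProd_contra hφ hu] at h₁₂₃
    linear_combination (3 / 2 : ℝ) * h₁₂₃
  · rw [T.schouten_eq g hφ hu h₁ h₂ h₃, g.symProd_contra hφ hu]
    linear_combination (2 / 3 : ℝ) *
      h (pull φ (g.grad f₁) u) (pull φ (g.grad f₂) u) (pull φ (g.grad f₃) u)

end SchoutenBracket

noncomputable section AdaptedParametrizations

variable {E M V : Type*} [NormedAddCommGroup E] [NormedSpace ℝ E]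
  [TopologicalSpace M] [ChartedSpace E M] [IsManifold 𝓘(ℝ, E) ∞ M]
  [NormedAddCommGroup V] [NormedSpace ℝ V]

/-- The parametrization `φ` takes a distribution `D` and its orthogonal complement to the range
and the kernel of a constant projection `P`; in particular both distributions are integrable. -/
structure Metric.IsAdapted (g : Metric E M) (D : ∀ p : M, Submodule ℝ (TangentSpace 𝓘(ℝ, E) p))
    (φ : OpenPartialHomeomorph V M) (P : V →L[ℝ] V) : Prop where
  idem : IsIdempotentElem P
  mem_iff : ∀ u ∈ φ.source, ∀ v, push φ u v ∈ D (φ u) ↔ P v = v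
  pullback_proj : ∀ u ∈ φ.source, ∀ v w, g.pullback φ u (P v) w = g.pullback φ u v (P w)

variable {g : Metric E M} {D : ∀ p : M, Submodule ℝ (TangentSpace 𝓘(ℝ, E) p)}
  {φ : OpenPartialHomeomorph V M} {P : V →L[ℝ] V} {u : V}

namespace Metric.IsAdapted

theorem proj_proj (h : g.IsAdapted D φ P) (v : V) : P (P v) = P v :=
  DFunLike.congr_fun h.idem v

theorem proj_sub_proj (h : g.IsAdapted D φ P) (v : V) : P (v - P v) = 0 := by
  rw [map_sub, h.proj_proj, sub_self]

theorem push_proj_mem (h : g.IsAdapted D φ P) (hu : u ∈ φ.source) (v : V) :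
    push φ u (P v) ∈ D (φ u) :=
  (h.mem_iff u hu _).2 (h.proj_proj v)

theorem push_sub_proj_mem_perp (h : g.IsAdapted D φ P) (hφ : IsParametrization E φ)
    (hu : u ∈ φ.source) (v : V) : push φ u (v - P v) ∈ g.perp (φ u) (D (φ u)) := by
  intro w hw
  obtain ⟨w, rfl⟩ := hφ.push_surjective hu w
  rw [← g.pullback_apply, ← (h.mem_iff u hu w).1 hw, ← h.pullback_proj u hu, h.proj_sub_proj,
    map_zero, zero_apply]

theorem isCompl (h : g.IsAdapted D φ P) (hφ : IsParametrization E φ) (hu : u ∈ φ.source) :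
    IsCompl (D (φ u)) (g.perp (φ u) (D (φ u))) := by
  refine isCompl_iff.2 ⟨Submodule.disjoint_def.2 fun v hv hv' => ?_, codisjoint_iff.2 ?_⟩
  · obtain ⟨v, rfl⟩ := hφ.push_surjective hu v
    rw [g.pullback_nondegenerate hφ hu v fun w => ?_, map_zero]
    rw [← (h.mem_iff u hu v).1 hv, h.pullback_proj u hu, g.pullback_apply]
    exact hv' _ (h.push_proj_mem hu w)
  · refine eq_top_iff.2 fun v _ => ?_
    obtain ⟨v, rfl⟩ := hφ.push_surjective hu v
    rw [← add_sub_cancel (P v) v, map_add]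
    exact Submodule.add_mem_sup (h.push_proj_mem hu v) (h.push_sub_proj_mem_perp hφ hu v)

theorem proj_push (h : g.IsAdapted D φ P) (hφ : IsParametrization E φ) (hu : u ∈ φ.source)
    (v : V) : g.proj (φ u) (D (φ u)) (push φ u v) = push φ u (P v) := by
  rw [Metric.proj, dif_pos (h.isCompl hφ hu)]
  conv_lhs => rw [← add_sub_cancel (P v) v, map_add, map_add]
  rw [Submodule.projection_apply_of_mem_left _ (h.push_proj_mem hu v),
    (Submodule.projection_apply_eq_zero_iff _).2 (h.push_sub_proj_mem_perp hφ hu v), add_zero]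

theorem proj_pull (h : g.IsAdapted D φ P) (hφ : IsParametrization E φ) (hu : u ∈ φ.source)
    {X : ∀ p : M, TangentSpace 𝓘(ℝ, E) p} (hX : X (φ u) ∈ D (φ u)) :
    P (pull φ X u) = pull φ X u :=
  (h.mem_iff u hu _).1 (by rwa [hφ.push_pull hu])

theorem pull_extendIn (h : g.IsAdapted D φ P) (hφ : IsParametrization E φ) (hu : u ∈ φ.source)
    (p : M) (x : TangentSpace 𝓘(ℝ, E) p) :
    pull φ (g.extendIn D p x) u = P (pull φ (FiberBundle.extend E x) u) := by
  rw [hφ.pull_eq_iff hu, ← h.proj_push hφ hu, hφ.push_pull hu]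
  rfl

/-- A bump function extends a vector field that is constant in the parametrization. -/
theorem exists_section [FiniteDimensional ℝ E] [T2Space M] (h : g.IsAdapted D φ P)
    (hφ : IsParametrization E φ) (hu : u ∈ φ.source) {x : TangentSpace 𝓘(ℝ, E) (φ u)}
    (hx : x ∈ D (φ u)) :
    ∃ X : ∀ p : M, TangentSpace 𝓘(ℝ, E) p, IsSmoothField X ∧ (∀ p, X p ∈ D p) ∧ X (φ u) = x := by
  have := FiniteDimensional.complete ℝ E
  obtain ⟨x, rfl⟩ := hφ.push_surjective hu x
  have hx' := (h.mem_iff u hu x).1 hx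
  obtain ⟨ψ, -, hψ⟩ := (SmoothBumpFunction.nhds_basis_tsupport (I := 𝓘(ℝ, E)) (φ u)).mem_iff.1
    (φ.open_target.mem_nhds (φ.map_source hu))
  refine ⟨(ψ : M → ℝ) • pushField φ (fun _ => x), ?_, fun p => ?_, ?_⟩
  · refine ContMDiffOn.smul_section_of_tsupport (V := fun p : M => TangentSpace 𝓘(ℝ, E) p)
      ψ.contMDiff.contMDiffOn φ.open_target hψ fun q hq => ?_
    obtain ⟨w, hw, rfl⟩ := φ.image_source_eq_target.ge hq
    exact (hφ.smoothFieldAt_pushField hw contDiffAt_const).contMDiffWithinAt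
  · by_cases hp : p ∈ φ.target
    · obtain ⟨w, hw, rfl⟩ := φ.image_source_eq_target.ge hp
      refine Submodule.smul_mem _ _ ?_
      rw [hφ.pushField_apply hw]
      exact (h.mem_iff w hw x).2 hx'
    · have hψp : ψ p = 0 := image_eq_zero_of_notMem_tsupport fun hp' => hp (hψ hp')
      rw [Pi.smul_apply', hψp, zero_smul]
      exact zero_mem _
  · rw [Pi.smul_apply', hφ.pushField_apply hu, ψ.eq_one, one_smul]

variable [FiniteDimensional ℝ V] [FiniteDimensional ℝ E]

theorem fderiv_pullback_proj (h : g.IsAdapted D φ P) (hφ : IsParametrization E φ)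
    (hu : u ∈ φ.source) (z v w : V) :
    fderiv ℝ (g.pullback φ) u z (P v) w = fderiv ℝ (g.pullback φ) u z v (P w) := by
  have hdiff := g.differentiableAt_pullback hφ hu
  rw [fderiv_bilin_const hdiff, fderiv_bilin_const hdiff]
  refine DFunLike.congr_fun (Filter.EventuallyEq.fderiv_eq ?_) z
  filter_upwards [φ.open_source.mem_nhds hu] with y hy using h.pullback_proj y hy v w

/-- The component along `D` of a vector field tangent to `D` is constant in the parametrization, so
only the Christoffel symbols contribute. -/
theorem val_sff (h : g.IsAdapted D φ P) (hφ : IsParametrization E φ) (hu : u ∈ φ.source)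
    {X Y : ∀ p : M, TangentSpace 𝓘(ℝ, E) p} (hX : SmoothFieldAt X (φ u))
    (hY : SmoothFieldAt Y (φ u)) (hXD : P (pull φ X u) = pull φ X u)
    (hYD : ∀ w ∈ φ.source, P (pull φ Y w) = pull φ Y w) (v : V) :
    g.val (φ u) (g.sff D X Y (φ u)) (push φ u v) =
      -(1 / 2 : ℝ) * fderiv ℝ (g.pullback φ) u (v - P v) (pull φ X u) (pull φ Y u) := by
  have := FiniteDimensional.complete ℝ V
  have hDY : P (fderiv ℝ (pull φ Y) u (pull φ X u)) = fderiv ℝ (pull φ Y) u (pull φ X u) := by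
    have hPY : P ∘ pull φ Y =ᶠ[nhds u] pull φ Y := by
      filter_upwards [φ.open_source.mem_nhds hu] with w hw using hYD w hw
    have hY' := (hφ.differentiableAt_pull hu hY).hasFDerivAt
    rw [← P.comp_apply, ← (P.hasFDerivAt.comp u hY').fderiv, hPY.fderiv_eq]
  have hnormal : g.val (φ u) (g.sff D X Y (φ u)) (push φ u v) =
      g.val (φ u) (g.leviCivita X Y (φ u)) (push φ u (v - P v)) := by
    obtain ⟨n, hn⟩ := hφ.push_surjective hu (g.leviCivita X Y (φ u))
    rw [Metric.sff, ← hn, h.proj_push hφ hu, ← map_sub, ← g.pullback_apply, ← g.pullback_apply,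
      map_sub, map_sub, sub_apply, h.pullback_proj u hu]
  rw [hnormal, g.val_leviCivita hφ hu hX hY, christoffel, ← hDY, h.pullback_proj u hu, ← hXD,
    ← hYD u hu, h.fderiv_pullback_proj hφ hu, h.fderiv_pullback_proj hφ hu, h.proj_sub_proj]
  simp only [map_zero, add_zero, zero_sub]
  ring

theorem smoothFieldAt_extendIn (h : g.IsAdapted D φ P) (hφ : IsParametrization E φ)
    (hu : u ∈ φ.source) (x : TangentSpace 𝓘(ℝ, E) (φ u)) :
    SmoothFieldAt (g.extendIn D (φ u) x) (φ u) := by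
  have := FiniteDimensional.complete ℝ V
  have := FiniteDimensional.complete ℝ E
  have hx : SmoothFieldAt (FiberBundle.extend E x) (φ u) := FiberBundle.contMDiffAt_extend _ _ _
  refine (hφ.smoothFieldAt_pushField hu
    (P.contDiff.contDiffAt.comp u (hφ.contDiffAt_pull hu hx))).congr_of_eventuallyEq ?_
  filter_upwards [φ.open_target.mem_nhds (φ.map_source hu)] with q hq
  obtain ⟨w, hw, rfl⟩ := φ.image_source_eq_target.ge hq
  rw [hφ.pushField_apply hw, Function.comp_apply, ← h.pull_extendIn hφ hw, hφ.push_pull hw]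

theorem val_symmSff (h : g.IsAdapted D φ P) (hφ : IsParametrization E φ) (hu : u ∈ φ.source)
    (x y v : V) :
    g.val (φ u) (g.symmSff D (φ u) (push φ u (P x)) (push φ u (P y))) (push φ u v) =
      -(1 / 2 : ℝ) * fderiv ℝ (g.pullback φ) u (v - P v) (P x) (P y) := by
  have hpull (x : V) : pull φ (g.extendIn D (φ u) (push φ u (P x))) u = P x := by
    rw [h.pull_extendIn hφ hu, pull, FiberBundle.extend_apply_self,
      (hφ.isInvertible_push hu).inverse_apply_self, h.proj_proj]
  have hsff (x y : V) := h.val_sff hφ hu (h.smoothFieldAt_extendIn hφ hu (push φ u (P x)))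
    (h.smoothFieldAt_extendIn hφ hu (push φ u (P y)))
    (by rw [h.pull_extendIn hφ hu, h.proj_proj])
    (fun w hw => by rw [h.pull_extendIn hφ hw, h.proj_proj]) v
  rw [Metric.symmSff, map_smul, map_add, smul_apply, add_apply, hsff x y, hsff y x, hpull, hpull,
    fderiv_bilin_symm (g.differentiableAt_pullback hφ hu) (g.pullback_symm φ) _ (P y), smul_eq_mul]
  ring

theorem sff_eq_symmSff (h : g.IsAdapted D φ P) (hφ : IsParametrization E φ) (hu : u ∈ φ.source)
    {X Y : ∀ p : M, TangentSpace 𝓘(ℝ, E) p} (hX : IsSmoothField X) (hY : IsSmoothField Y)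
    (hXD : ∀ p, X p ∈ D p) (hYD : ∀ p, Y p ∈ D p) :
    g.sff D X Y (φ u) = g.symmSff D (φ u) (X (φ u)) (Y (φ u)) := by
  have hXu := h.proj_pull hφ hu (hXD (φ u))
  have hYu {w : V} (hw : w ∈ φ.source) := h.proj_pull hφ hw (hYD (φ w))
  refine sub_eq_zero.1 (g.nondegenerate _ _ fun v => ?_)
  obtain ⟨v, rfl⟩ := hφ.push_surjective hu v
  have hsymm := h.val_symmSff hφ hu (pull φ X u) (pull φ Y u) v
  rw [hXu, hYu hu, hφ.push_pull hu, hφ.push_pull hu] at hsymm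
  rw [map_sub, sub_apply, h.val_sff hφ hu hX.contMDiffAt hY.contMDiffAt hXu fun w hw => hYu hw,
    hsymm, sub_self]

end Metric.IsAdapted

variable {ι : Type*} [Fintype ι] [DecidableEq ι]
  {D : ι → ∀ p : M, Submodule ℝ (TangentSpace 𝓘(ℝ, E) p)}

theorem Metric.IsIntegrableNet.exists_isAdapted (h : g.IsIntegrableNet D) (p : M) :
    ∃ (m : ι → ℕ) (φ : OpenPartialHomeomorph (∀ i, EuclideanSpace ℝ (Fin (m i))) M)
      (P : ι → (∀ i, EuclideanSpace ℝ (Fin (m i))) →L[ℝ] (∀ i, EuclideanSpace ℝ (Fin (m i)))),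
      IsParametrization E φ ∧ CompleteOrthogonalIdempotents P ∧
        (∀ i, g.IsAdapted (D i) φ (P i)) ∧ p ∈ φ '' φ.source := by
  obtain ⟨m, U, φ, -, -, hp, hs, hs', hD⟩ := h.adapted p
  have hφ : IsParametrization E φ := ⟨hs, hs'⟩
  have hP := completeOrthogonalIdempotents_coordProj fun i => EuclideanSpace ℝ (Fin (m i))
  have hmem (i : ι) (u) (hu : u ∈ φ.source) (v) :
      push φ u v ∈ D i (φ u) ↔ coordProj _ i v = v := by
    refine (Set.ext_iff.1 (hD u hu i) (push φ u v)).trans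
      ⟨?_, fun hv => ⟨v i, congrArg (push (E := E) φ u) hv⟩⟩
    rintro ⟨w, hw⟩
    obtain rfl : Pi.single i w = v := hφ.push_injective hu hw
    simp [coordProj]
  refine ⟨m, φ, _, hφ, hP, fun i => ⟨hP.idem i, hmem i, fun u hu => ?_⟩,
    φ.image_source_eq_target.ge hp⟩
  refine isBlockDiag_of_orthogonal hP (fun i j hij x y => ?_) i
  exact h.orthogonal i j hij _ _ ((hmem i u hu _).2 (proj_proj_self hP i x)) _
    ((hmem j u hu _).2 (proj_proj_self hP j y))

end AdaptedParametrizations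

noncomputable section Umbilicity

variable {E M V : Type*} [NormedAddCommGroup E] [NormedSpace ℝ E] [FiniteDimensional ℝ E]
  [TopologicalSpace M] [ChartedSpace E M] [IsManifold 𝓘(ℝ, E) ∞ M]
  {g : Metric E M} {D : ∀ p : M, Submodule ℝ (TangentSpace 𝓘(ℝ, E) p)}
  {p : M} {N : TangentSpace 𝓘(ℝ, E) p}

/-- The distribution `D` is umbilical at the point `p` with normal vector `N`: its second
fundamental form there is `g ⊗ N`. -/
def Metric.IsUmbilicalAt (g : Metric E M) (D : ∀ p : M, Submodule ℝ (TangentSpace 𝓘(ℝ, E) p))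
    (p : M) (N : TangentSpace 𝓘(ℝ, E) p) : Prop :=
  ∀ x ∈ D p, ∀ y ∈ D p, g.symmSff D p x y = g.val p x y • N

theorem Metric.isUnit_det_gram (hD : ∀ v ∈ D p, (∀ w ∈ D p, g.val p v w = 0) → v = 0) :
    IsUnit (g.gram D p).det := by
  let B : LinearMap.BilinForm ℝ (D p) :=
    (g.val p).toLinearMap₁₂.domRestrict₁₂ (D p) (D p)
  have hB : B.SeparatingLeft := fun v hv =>
    Subtype.ext (hD v v.2 fun w hw => hv ⟨w, hw⟩)
  have hBr : B.IsSymm := ⟨fun v w => g.symm p v w⟩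
  have hgram : g.gram D p = LinearMap.BilinForm.toMatrix (Module.finBasis ℝ (D p)) B := by
    ext a b
    rw [LinearMap.BilinForm.toMatrix_apply]
    rfl
  rw [hgram, isUnit_iff_ne_zero]
  exact (LinearMap.BilinForm.nondegenerate_iff_det_ne_zero _).1
    (hBr.isRefl.nondegenerate_iff_separatingLeft.2 hB)

theorem Metric.sum_inv_gram_mul_gram (h : IsUnit (g.gram D p).det) :
    ∑ a, ∑ b, (g.gram D p)⁻¹ a b * g.gram D p b a = Module.finrank ℝ (D p) := by
  have htrace := congrArg Matrix.trace (Matrix.nonsing_inv_mul _ h)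
  rwa [Matrix.trace_one, Fintype.card_fin] at htrace

theorem Metric.IsUmbilicalAt.meanCurvatureNormal_eq (h : g.IsUmbilicalAt D p N) (hne : D p ≠ ⊥)
    (hD : ∀ v ∈ D p, (∀ w ∈ D p, g.val p v w = 0) → v = 0) :
    g.meanCurvatureNormal D p = N := by
  have hrank : (Module.finrank ℝ (D p) : ℝ) ≠ 0 :=
    Nat.cast_ne_zero.2 fun h0 => hne (Submodule.finrank_eq_zero.1 h0)
  have hsymmSff (a b : Fin (Module.finrank ℝ (D p))) :
      g.symmSff D p (Module.finBasis ℝ (D p) a) (Module.finBasis ℝ (D p) b) =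
        g.gram D p b a • N := by
    rw [h _ (Subtype.prop _) _ (Subtype.prop _), g.symm]
    rfl
  rw [Metric.meanCurvatureNormal]
  simp only [hsymmSff, smul_smul, ← Finset.sum_smul]
  rw [Metric.sum_inv_gram_mul_gram (Metric.isUnit_det_gram hD), inv_mul_cancel₀ hrank, one_smul]

theorem Metric.IsAdapted.isUmbilicalAt_iff [NormedAddCommGroup V] [NormedSpace ℝ V]
    [FiniteDimensional ℝ V] {φ : OpenPartialHomeomorph V M} {P : V →L[ℝ] V} {u : V}
    (h : g.IsAdapted D φ P) (hφ : IsParametrization E φ) (hu : u ∈ φ.source)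
    (N : TangentSpace 𝓘(ℝ, E) (φ u)) :
    g.IsUmbilicalAt D (φ u) N ↔ ∀ v x y,
      -(1 / 2 : ℝ) * fderiv ℝ (g.pullback φ) u (v - P v) (P x) y =
        g.pullback φ u (P x) y * g.val (φ u) N (push φ u v) := by
  have hval (v x y : V) : g.val (φ u)
      (g.symmSff D (φ u) (push φ u (P x)) (push φ u (P y))) (push φ u v) =
        -(1 / 2 : ℝ) * fderiv ℝ (g.pullback φ) u (v - P v) (P x) y := by
    rw [h.val_symmSff hφ hu, ← h.fderiv_pullback_proj hφ hu, h.proj_proj]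
  have hval' (v x y : V) : g.val (φ u)
      (g.val (φ u) (push φ u (P x)) (push φ u (P y)) • N) (push φ u v) =
        g.pullback φ u (P x) y * g.val (φ u) N (push φ u v) := by
    rw [map_smul, smul_apply, smul_eq_mul, ← g.pullback_apply, ← h.pullback_proj u hu, h.proj_proj]
  refine ⟨fun hN v x y => ?_, fun hN x hx y hy => sub_eq_zero.1 (g.nondegenerate _ _ fun v => ?_)⟩
  · rw [← hval, ← hval', hN _ (h.push_proj_mem hu x) _ (h.push_proj_mem hu y)]
  · obtain ⟨x, rfl⟩ := hφ.push_surjective hu x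
    obtain ⟨y, rfl⟩ := hφ.push_surjective hu y
    obtain ⟨v, rfl⟩ := hφ.push_surjective hu v
    rw [map_sub, sub_apply, ← (h.mem_iff u hu x).1 hx, ← (h.mem_iff u hu y).1 hy, hval, hval', hN,
      sub_self]

variable {ι : Type*} [Fintype ι] [DecidableEq ι]
  {D : ι → ∀ p : M, Submodule ℝ (TangentSpace 𝓘(ℝ, E) p)}

theorem Metric.IsIntegrableNet.isUmbilical_iff [T2Space M] (h : g.IsIntegrableNet D) (i : ι) :
    g.IsUmbilical (D i) ↔ ∀ p, g.IsUmbilicalAt (D i) p (g.meanCurvatureNormal (D i) p) := by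
  refine ⟨fun hD p x hx y hy => ?_, fun hD X Y hX hY hXD hYD p => ?_⟩
  · obtain ⟨m, φ, P, hφ, -, hP, u, hu, rfl⟩ := h.exists_isAdapted p
    obtain ⟨X, hX, hXD, rfl⟩ := (hP i).exists_section hφ hu hx
    obtain ⟨Y, hY, hYD, rfl⟩ := (hP i).exists_section hφ hu hy
    rw [← (hP i).sff_eq_symmSff hφ hu hX hY hXD hYD, hD X Y hX hY hXD hYD]
  · obtain ⟨m, φ, P, hφ, -, hP, u, hu, rfl⟩ := h.exists_isAdapted p
    rw [(hP i).sff_eq_symmSff hφ hu hX hY hXD hYD, hD _ _ (hXD _) _ (hYD _)]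

theorem Metric.IsIntegrableNet.isUmbilical_and_meanCurvatureNormal_eq_iff [T2Space M]
    (h : g.IsIntegrableNet D) {i : ι} (hi : ∀ p, D i p ≠ ⊥)
    (N : ∀ p : M, TangentSpace 𝓘(ℝ, E) p) :
    (g.IsUmbilical (D i) ∧ ∀ p, g.meanCurvatureNormal (D i) p = N p) ↔
      ∀ p, g.IsUmbilicalAt (D i) p (N p) := by
  rw [h.isUmbilical_iff]
  refine ⟨fun ⟨hD, hN⟩ p => hN p ▸ hD p, fun hD => ?_⟩
  have hN p := (hD p).meanCurvatureNormal_eq (hi p) (h.nondegenerate i p)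
  exact ⟨fun p => (hN p).symm ▸ hD p, hN⟩

end Umbilicity

noncomputable section Eigenfunctions

variable {E M V : Type*} [NormedAddCommGroup E] [NormedSpace ℝ E] [FiniteDimensional ℝ E]
  [TopologicalSpace M] [ChartedSpace E M] [IsManifold 𝓘(ℝ, E) ∞ M]
  [NormedAddCommGroup V] [NormedSpace ℝ V]
  {g : Metric E M} {T : SymTensor E M} {φ : OpenPartialHomeomorph V M} {u : V}

theorem Metric.IsAdapted.val_proj_grad
    {D : ∀ p : M, Submodule ℝ (TangentSpace 𝓘(ℝ, E) p)} {P : V →L[ℝ] V} {f : M → ℝ}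
    (h : g.IsAdapted D φ P) (hφ : IsParametrization E φ) (hu : u ∈ φ.source)
    (hf : DifferentiableAt ℝ (fun w => f (φ w)) u) (v : V) :
    g.val (φ u) (g.proj (φ u) (D (φ u)) (g.grad f (φ u))) (push φ u v) =
      fderiv ℝ (fun w => f (φ w)) u (P v) := by
  rw [← hφ.push_pull hu (g.grad f), h.proj_push hφ hu, ← g.pullback_apply, h.pullback_proj u hu,
    g.pullback_pull_grad hφ hu hf]

variable {ι : Type*} {l : ι → M → ℝ}

theorem SymTensor.IsEigenfunctions.eigendist_ne_bot (hl : T.IsEigenfunctions g l) (i : ι) (p : M) :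
    T.eigendist g (l i) p ≠ ⊥ :=
  (hl.hasEigenvalue_iff p (l i p)).2 ⟨i, rfl⟩

variable [Fintype ι] {P : ι → V →L[ℝ] V}
  {t : ∀ p : M, TangentSpace 𝓘(ℝ, E) p}

/-- The sum of the components of the gradients of the eigenfunctions along their own
eigenspaces; the only possible conformal factor. -/
def SymTensor.eigenGrad (T : SymTensor E M) (g : Metric E M) (l : ι → M → ℝ) (p : M) :
    TangentSpace 𝓘(ℝ, E) p :=
  ∑ i, g.proj p (T.eigendist g (l i) p) (g.grad (l i) p)

theorem SymTensor.eq_eigenGrad_iff (hP : CompleteOrthogonalIdempotents P)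
    (h : ∀ i, g.IsAdapted (T.eigendist g (l i)) φ (P i)) (hφ : IsParametrization E φ)
    (hu : u ∈ φ.source) (hl : ∀ i, DifferentiableAt ℝ (fun w => l i (φ w)) u) :
    t (φ u) = T.eigenGrad g l (φ u) ↔ ∀ i x,
      fderiv ℝ (fun w => l i (φ w)) u (P i x) = g.pullback φ u (pull φ t u) (P i x) := by
  have hval (v : V) : g.val (φ u) (T.eigenGrad g l (φ u)) (push φ u v) =
      ∑ i, fderiv ℝ (fun w => l i (φ w)) u (P i v) := by
    rw [SymTensor.eigenGrad, map_sum, sum_apply]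
    exact Finset.sum_congr rfl fun i _ => (h i).val_proj_grad hφ hu (hl i) v
  refine ⟨fun ht i x => ?_, fun ht => sub_eq_zero.1 (g.nondegenerate _ _ fun v => ?_)⟩
  · rw [g.pullback_apply, hφ.push_pull hu, ht, hval, Finset.sum_eq_single i
      (fun j _ hj => by rw [proj_proj_of_ne hP hj, map_zero])
      (fun hi => absurd (Finset.mem_univ i) hi), proj_proj_self hP]
  · obtain ⟨v, rfl⟩ := hφ.push_surjective hu v
    rw [map_sub, sub_apply, hval, ← hφ.push_pull hu t, ← g.pullback_apply, sub_eq_zero]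
    conv_lhs => rw [← sum_proj_apply hP v, map_sum]
    exact Finset.sum_congr rfl fun i _ => (ht i v).symm

/-- Minus one half the sum, over the other eigenspaces, of the components of the gradients of the
logarithms of the eigenvalue gaps; the mean curvature normal that the `i`-th eigenspace of a
conformal Killing tensor must have. -/
def SymTensor.logGapNormal [DecidableEq ι] (T : SymTensor E M) (g : Metric E M) (l : ι → M → ℝ)
    (i : ι) (p : M) : TangentSpace 𝓘(ℝ, E) p :=
  -(1 / 2 : ℝ) • ∑ j ∈ Finset.univ.erase i,
    g.proj p (T.eigendist g (l j) p) (g.grad (fun q => Real.log |l i q - l j q|) p)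

theorem SymTensor.val_logGapNormal [DecidableEq ι]
    (h : ∀ i, g.IsAdapted (T.eigendist g (l i)) φ (P i)) (hφ : IsParametrization E φ)
    (hu : u ∈ φ.source) (hl : ∀ i, DifferentiableAt ℝ (fun w => l i (φ w)) u)
    (hinj : Function.Injective fun i => l i (φ u)) (i : ι) (v : V) :
    g.val (φ u) (T.logGapNormal g l i (φ u)) (push φ u v) =
      -(1 / 2) * ∑ j ∈ Finset.univ.erase i, (l i (φ u) - l j (φ u))⁻¹ *
        (fderiv ℝ (fun w => l i (φ w)) u - fderiv ℝ (fun w => l j (φ w)) u) (P j v) := by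
  rw [SymTensor.logGapNormal, map_smul, smul_apply, smul_eq_mul, map_sum, sum_apply]
  congr 1
  refine Finset.sum_congr rfl fun j hj => ?_
  have hgap : l i (φ u) - l j (φ u) ≠ 0 :=
    sub_ne_zero.2 (hinj.ne (Finset.ne_of_mem_erase hj).symm)
  have hlog := ((hl i).hasFDerivAt.fun_sub (hl j).hasFDerivAt).log hgap
  simp only [← Real.log_abs (l i _ - l j _)] at hlog
  rw [(h j).val_proj_grad hφ hu hlog.differentiableAt, hlog.fderiv]
  rfl

variable [FiniteDimensional ℝ V]

theorem Metric.IsAdapted.pullEndo_proj {f : M → ℝ} {P : V →L[ℝ] V}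
    (h : g.IsAdapted (T.eigendist g f) φ P) (hφ : IsParametrization E φ) (hu : u ∈ φ.source)
    (v : V) : T.pullEndo g φ u (P v) = f (φ u) • P v := by
  apply hφ.push_injective hu
  rw [T.push_pullEndo g hφ hu, map_smul]
  exact Module.End.mem_eigenspace_iff.1 (h.push_proj_mem hu v)

theorem Metric.IsAdapted.differentiableAt_eigenfunction {f : M → ℝ} {P : V →L[ℝ] V}
    (h : g.IsAdapted (T.eigendist g f) φ P) (hφ : IsParametrization E φ) (hu : u ∈ φ.source)
    (hf : T.eigendist g f (φ u) ≠ ⊥) : DifferentiableAt ℝ (fun w => f (φ w)) u := by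
  obtain ⟨x, hx, hx0⟩ := Submodule.exists_mem_ne_zero_of_ne_bot hf
  obtain ⟨v, rfl⟩ := hφ.push_surjective hu x
  obtain ⟨α, hα⟩ := SeparatingDual.exists_eq_one (R := ℝ) fun hv : v = 0 =>
    hx0 (by rw [hv, map_zero])
  refine (α.differentiableAt.comp u ((T.differentiableAt_pullEndo g hφ hu).clm_apply
    (differentiableAt_const v))).congr_of_eventuallyEq ?_
  filter_upwards [φ.open_source.mem_nhds hu] with w hw
  have hSv := h.pullEndo_proj hφ hw v
  rw [(h.mem_iff u hu v).1 hx] at hSv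
  rw [Function.comp_apply, hSv, map_smul, hα, smul_eq_mul, mul_one]

theorem SymTensor.pullEndo_eq_blockScalar (hP : CompleteOrthogonalIdempotents P)
    (h : ∀ i, g.IsAdapted (T.eigendist g (l i)) φ (P i)) (hφ : IsParametrization E φ)
    (hu : u ∈ φ.source) : T.pullEndo g φ u = blockScalar P fun i => l i (φ u) := by
  ext v
  rw [← sum_proj_apply hP v, map_sum, map_sum]
  exact Finset.sum_congr rfl fun i _ => by
    rw [(h i).pullEndo_proj hφ hu, blockScalar_proj hP]

theorem SymTensor.fderiv_pullEndo_eq_blockScalar (hP : CompleteOrthogonalIdempotents P)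
    (h : ∀ i, g.IsAdapted (T.eigendist g (l i)) φ (P i)) (hφ : IsParametrization E φ)
    (hu : u ∈ φ.source) (hl : ∀ i, DifferentiableAt ℝ (fun w => l i (φ w)) u) :
    ⇑(fderiv ℝ (T.pullEndo g φ) u) =
      fun z => blockScalar P fun i => fderiv ℝ (fun w => l i (φ w)) u z := by
  have hS : T.pullEndo g φ =ᶠ[nhds u]
      (blockScalar P).toContinuousLinearMap ∘ fun w i => l i (φ w) := by
    filter_upwards [φ.open_source.mem_nhds hu] with w hw
    exact T.pullEndo_eq_blockScalar hP h hφ hw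
  rw [hS.fderiv_eq, ((blockScalar P).toContinuousLinearMap.hasFDerivAt.comp u
    (hasFDerivAt_pi.2 fun i => (hl i).hasFDerivAt)).fderiv]
  rfl

theorem SymTensor.killingEq_iff [DecidableEq ι] (hP : CompleteOrthogonalIdempotents P)
    (h : ∀ i, g.IsAdapted (T.eigendist g (l i)) φ (P i)) (hφ : IsParametrization E φ)
    (hu : u ∈ φ.source) (hne : ∀ i, T.eigendist g (l i) (φ u) ≠ ⊥)
    (hinj : Function.Injective fun i => l i (φ u)) :
    KillingEq (g.pullback φ u) (fderiv ℝ (g.pullback φ) u) (T.pullEndo g φ u)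
        (fderiv ℝ (T.pullEndo g φ) u) (pull φ t u) ↔
      (∀ i, g.IsUmbilicalAt (T.eigendist g (l i)) (φ u) (T.logGapNormal g l i (φ u))) ∧
        t (φ u) = T.eigenGrad g l (φ u) := by
  have hl i := (h i).differentiableAt_eigenfunction hφ hu (hne i)
  rw [T.pullEndo_eq_blockScalar hP h hφ hu, T.fderiv_pullEndo_eq_blockScalar hP h hφ hu hl,
    T.eq_eigenGrad_iff hP h hφ hu hl]
  simp only [(h _).isUmbilicalAt_iff hφ hu, T.val_logGapNormal h hφ hu hl hinj]
  exact (killingEq_blockScalar_iff (Dg := (fderiv ℝ (g.pullback φ) u).toLinearMap) hP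
    (fun i => (h i).pullback_proj u hu) (fun z i => (h i).fderiv_pullback_proj hφ hu z)
    (g.pullback_symm φ u) (g.pullback_nondegenerate hφ hu)).trans
    (and_congr_left' (block_equations_iff_umbilic hP hinj))

theorem SymTensor.isConformalKilling_iff [T2Space M] [DecidableEq ι] (hl : T.IsEigenfunctions g l)
    (hnet : g.IsIntegrableNet fun i => T.eigendist g (l i)) :
    T.IsConformalKilling g t ↔ ∀ p,
      (∀ i, g.IsUmbilicalAt (T.eigendist g (l i)) p (T.logGapNormal g l i p)) ∧
        t p = T.eigenGrad g l p := by
  have hkilling (p : M) : (∀ f₁ f₂ f₃ : M → ℝ, ContMDiff 𝓘(ℝ, E) 𝓘(ℝ, ℝ) ∞ f₁ →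
      ContMDiff 𝓘(ℝ, E) 𝓘(ℝ, ℝ) ∞ f₂ → ContMDiff 𝓘(ℝ, E) 𝓘(ℝ, ℝ) ∞ f₃ →
      schouten (fun q α β => T.val q α β) g.contra f₁ f₂ f₃ p
        = -2 * symProd (t p) (g.contra p) (diff f₁ p) (diff f₂ p) (diff f₃ p)) ↔
      (∀ i, g.IsUmbilicalAt (T.eigendist g (l i)) p (T.logGapNormal g l i p)) ∧
        t p = T.eigenGrad g l p := by
    obtain ⟨m, φ, P, hφ, hP, h, u, hu, rfl⟩ := hnet.exists_isAdapted p
    exact (T.isConformalKilling_at_iff g hφ hu t).trans (T.killingEq_iff hP h hφ hu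
      (fun i => hl.eigendist_ne_bot i _) (hl.distinct _))
  exact ⟨fun h p => (hkilling p).1 fun f₁ f₂ f₃ h₁ h₂ h₃ => h f₁ f₂ f₃ h₁ h₂ h₃ p,
    fun h f₁ f₂ f₃ h₁ h₂ h₃ p => (hkilling p).2 (h p) f₁ f₂ f₃ h₁ h₂ h₃⟩

end Eigenfunctions

end PseudoRiem

theorem mainTheorem5 {E M : Type*} [NormedAddCommGroup E] [NormedSpace ℝ E]
    [FiniteDimensional ℝ E] [TopologicalSpace M] [T2Space M] [ChartedSpace E M]
    [IsManifold 𝓘(ℝ, E) ∞ M] (g : PseudoRiem.Metric E M) (T : PseudoRiem.SymTensor E M)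
    (hT : T.IsOrthogonal g) {ι : Type*} [Fintype ι] [DecidableEq ι] (l : ι → M → ℝ)
    (hl : T.IsEigenfunctions g l) (hnet : g.IsIntegrableNet fun i => T.eigendist g (l i))
    (t : ∀ p : M, TangentSpace 𝓘(ℝ, E) p) (ht : PseudoRiem.IsSmoothField t) :
    T.IsConformalKilling g t ↔
      (∀ i, g.IsUmbilical (T.eigendist g (l i))) ∧
      (∀ i p, g.meanCurvatureNormal (T.eigendist g (l i)) p =
        -(1 / 2 : ℝ) • ∑ j ∈ Finset.univ.erase i,
          g.proj p (T.eigendist g (l j) p) (g.grad (fun q => Real.log |l i q - l j q|) p)) ∧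
      (∀ p, t p = ∑ i, g.proj p (T.eigendist g (l i) p) (g.grad (l i) p)) := by
  have humb i := hnet.isUmbilical_and_meanCurvatureNormal_eq_iff (hl.eigendist_ne_bot i)
    (T.logGapNormal g l i)
  rw [PseudoRiem.SymTensor.isConformalKilling_iff hl hnet]
  constructor
  · intro h
    have hnormal i := (humb i).2 fun p => (h p).1 i
    exact ⟨fun i => (hnormal i).1, fun i => (hnormal i).2, fun p => (h p).2⟩
  · rintro ⟨humbilical, hnormal, hfactor⟩ p
    exact ⟨fun i => (humb i).1 ⟨humbilical i, hnormal i⟩ p, hfactor p⟩
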